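/- Consider a bipartite Bell scenario with two inputs $x,y\in\{0,1\}$ and two outputs $a,b\in\{0,1\}$ per party; for a block of $N$ runs write $\vec a,\vec b,\vec x,\vec y\in\{0,1\}^N$. Let $\mathcal P_N$ be the set of probability distributions $P(\vec a\vec b\vec x\vec y)$, $P(\vec x\vec y)=\sum_{\vec a,\vec b}P(\vec a\vec b\vec x\vec y)$, and $P(\vec a\vec b|\vec x\vec y)=P(\vec a\vec b\vec x\vec y)/P(\vec x\vec y)$. The uniform slice of $\mathcal P_N$ is given by $P(\vec x\vec y)=1/4^N$. Below, integrals over $\lambda$ are averages over a hidden variable with an arbitrary probability law $w$. * For $h\ge 0$, $\mathrm{MDL}_N$ is the set of $P\in\mathcal P_N$ of the form $P(\vec a\vec b\vec x\vec y)=\int d\lambda\,w(\lambda)P(\vec a|\vec x\lambda)P(\vec b|\vec y\lambda)P(\vec x\vec y|\lambda)$, the factors being (conditional) probability distributions with $P(\vec x\vec y|\lambda)\le h^N$. * $\mathrm{NS}_1$ is the set of $P\in\mathcal P_1$ whose conditional probabilities are no-signalling: $\sum_b P(ab|xy)$ does not depend on $y$ and $\sum_a P(ab|xy)$ does not depend on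 $x$. $\mathrm{NS}_1^{\times N}$ is the set of $P\in\mathcal P_N$ of the form $P(\vec a\vec b\vec x\vec y)=\big(\int d\lambda\,w(\lambda)\prod_{j=1}^N P_{q_j(\lambda)}(a_jb_j|x_jy_j)\big)P(\vec x\vec y)$ with all $q_j(\lambda)\in\mathrm{NS}_1$. * $Q_N$ is the set of $P\in\mathcal P_N$ of the form $P(\vec a\vec b\vec x\vec y)=\big(\int d\lambda\,w(\lambda)\,\mathrm{Tr}[\rho(\lambda)(\Pi_{\vec a|\vec x}(\lambda)\otimes\Pi_{\vec b|\vec y}(\lambda))]\big)P(\vec x\vec y)$, with density operators $\rho(\lambda)$ on tensor products of two Hilbert spaces of unrestricted dimension and projective measurements $\Pi$. * The coarse-graining $c_N:\mathcal P_N\to\mathcal P_1$ is $P_{c_N(p)}(abxy)=\frac1N\sum_{j=1}^N\sum P_p(\vec a\vec b\vec x\vec y)$, the inner sum being over all tuples with $(a_j,b_j,x_j,y_j)=(a,b,x,y)$. * The uniform PR box is $P_{\mathrm{PR}}(abxy)=\frac14\cdot\frac12$ if $a\oplus b=xy$, and $0$ otherwise. * A local deterministic strategy on blocks of $N$ runs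 is a pair of functions $\vec a=f(\vec x)$, $\vec b=g(\vec y)$. It is a $k$-mismatch strategy with respect to $q\in\mathcal P_1$ if $k$ is the number of pairs $(\vec x,\vec y)$ for which $P(\vec x\vec y)$ must be $0$ in order that the coarse-graining $c_N$ of the distribution produced by $(f,g)$ and the input distribution $P(\vec x\vec y)$ vanishes wherever $q$ vanishes. In the following statements all sets are restricted to their uniform slices, except where noted. 1. $c_2(\mathrm{NS}_1^{\times 2})=\mathrm{NS}_1$. 2. For every $h\ge 0$: $\mathrm{NS}_1=c_2(\mathrm{NS}_1^{\times2})\subseteq c_2(\mathrm{MDL}_2)$ if and only if $h\ge 1/\sqrt{10}$. 3. Every local deterministic strategy on blocks of two runs is a $k$-mismatch strategy with respect to the uniform PR box for some $k\ge 6$. The uniform PR box lies in $\mathrm{NS}_1$, and for $0\le h<1/\sqrt{10}$ it is not in $c_2(\mathrm{MDL}_2)$, even if $\mathrm{MDL}_2$ is not restricted to the uniform slice. 4. For every $h\ge 1/\sqrt{10}$ and every $N\ge1$: $c_N(Q_N)\subseteq c_2(\mathrm{MDL}_2)$. 5. For every $0\le h<1/\sqrt{14}$: $Q_1\not\subseteq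 c_2(\mathrm{MDL}_2)$, even if $\mathrm{MDL}_2$ is not restricted to the uniform slice. -/

import Mathlib

open scoped TensorProduct InnerProductSpace
open MeasureTheory

noncomputable section

namespace BlockMDL

/-- A table of numbers indexed by outputs `a`, `b` and inputs `x`, `y`. It is used both for joint
probabilities `P(abxy)` and for conditional probabilities `P(ab|xy)`. For blocks of `N` runs all
four alphabets are `Fin N → Fin 2`. -/
abbrev Table (A B X Y : Type) := A → B → X → Y → ℝ

section General

variable {A B X Y : Type} [Fintype A] [Fintype B] [Fintype X] [Fintype Y]

/-- The set of all joint probability distributions `P(abxy)`. -/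
def probSpace (A B X Y : Type) [Fintype A] [Fintype B] [Fintype X] [Fintype Y] :
    Set (Table A B X Y) :=
  {p | (∀ a b x y, 0 ≤ p a b x y) ∧ ∑ a, ∑ b, ∑ x, ∑ y, p a b x y = 1}

/-- The input probabilities `P(xy) = ∑_{a,b} P(abxy)`. -/
def inputProb (p : Table A B X Y) (x : X) (y : Y) : ℝ := ∑ a, ∑ b, p a b x y

/-- The conditional probabilities `P(ab|xy) = P(abxy) / P(xy)`. -/
def condProb (p : Table A B X Y) : Table A B X Y :=
  fun a b x y => p a b x y / inputProb p x y

/-- The uniform-measurements slice `P(xy) = 1 / (|X| |Y|)`. -/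
def uniformInputs (A B X Y : Type) [Fintype A] [Fintype B] [Fintype X] [Fintype Y] :
    Set (Table A B X Y) :=
  {p | ∀ x y, inputProb p x y = 1 / ((Fintype.card X : ℝ) * (Fintype.card Y : ℝ))}

/-- The averages `∫ dλ w(λ) r_λ` of tables `r_λ ∈ S` over a hidden variable `λ` with an arbitrary
probability law `w`; the integrals are required to exist. -/
def hiddenAverages (S : Set (Table A B X Y)) : Set (Table A B X Y) :=
  {p | ∃ (Λ : Type) (_ : MeasurableSpace Λ) (w : Measure Λ) (_ : IsProbabilityMeasure w)
      (r : Λ → Table A B X Y),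
      (∀ l, r l ∈ S) ∧
      (∀ a b x y, Integrable (fun l => r l a b x y) w) ∧
      (∀ a b x y, p a b x y = ∫ l, r l a b x y ∂w)}

/-! ### Measurement-dependent local models -/

/-- `P(out | inp)` is a conditional probability distribution. -/
def IsCondDist {O I : Type} [Fintype O] (P : O → I → ℝ) : Prop :=
  (∀ o i, 0 ≤ P o i) ∧ ∀ i, ∑ o, P o i = 1

/-- `P(xy)` is a probability distribution on pairs of inputs. -/
def IsInputDist (P : X → Y → ℝ) : Prop :=
  (∀ x y, 0 ≤ P x y) ∧ ∑ x, ∑ y, P x y = 1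

/-- Distributions of the form `∫ dλ w(λ) P(a|xλ) P(b|yλ) P(xy|λ)` with `P(xy|λ) ≤ H`. -/
def mdlSet (A B X Y : Type) [Fintype A] [Fintype B] [Fintype X] [Fintype Y] (H : ℝ) :
    Set (Table A B X Y) :=
  {p | p ∈ probSpace A B X Y ∧
    p ∈ hiddenAverages {r : Table A B X Y |
      ∃ (PA : A → X → ℝ) (PB : B → Y → ℝ) (PXY : X → Y → ℝ),
        IsCondDist PA ∧ IsCondDist PB ∧ IsInputDist PXY ∧ (∀ x y, PXY x y ≤ H) ∧
        ∀ a b x y, r a b x y = PA a x * PB b y * PXY x y}}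

/-! ### No-signalling distributions -/

/-- The no-signalling conditions for conditional probabilities `P(ab|xy)`. -/
def NoSignalling (P : Table A B X Y) : Prop :=
  (∀ a x y y', ∑ b, P a b x y = ∑ b, P a b x y') ∧
  (∀ b y x x', ∑ a, P a b x y = ∑ a, P a b x' y)

/-- The distributions `P(abxy)` whose conditional probabilities are no-signalling. -/
def nsSet (A B X Y : Type) [Fintype A] [Fintype B] [Fintype X] [Fintype Y] :
    Set (Table A B X Y) :=
  {p | p ∈ probSpace A B X Y ∧ NoSignalling (condProb p)}

/-! ### Quantum distributions -/

/-- The Hilbert space tensor product: the completion of the algebraic tensor product. -/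
abbrev HilbertTensor (HA HB : Type) [NormedAddCommGroup HA] [InnerProductSpace ℂ HA]
    [NormedAddCommGroup HB] [InnerProductSpace ℂ HB] : Type :=
  UniformSpace.Completion (HA ⊗[ℂ] HB)

/-- The bounded operator `S ⊗ T` on the Hilbert space tensor product. -/
def tensorOp {HA HB : Type} [NormedAddCommGroup HA] [InnerProductSpace ℂ HA]
    [NormedAddCommGroup HB] [InnerProductSpace ℂ HB] (S : HA →L[ℂ] HA) (T : HB →L[ℂ] HB) :
    HilbertTensor HA HB →L[ℂ] HilbertTensor HA HB :=
  (TensorProduct.mapL S T).completion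

/-- `Tr T = t`: for every Hilbert basis `e`, the sum `∑ᵢ ⟨eᵢ, T eᵢ⟩` converges to `t`. -/
def HasTrace {H : Type} [NormedAddCommGroup H] [InnerProductSpace ℂ H]
    (T : H →L[ℂ] H) (t : ℂ) : Prop :=
  ∀ (ι : Type) (e : HilbertBasis ι ℂ H), HasSum (fun i => ⟪e i, T (e i)⟫_ℂ) t

/-- A density operator: a positive operator of trace one. -/
def IsDensityOperator {H : Type} [NormedAddCommGroup H] [InnerProductSpace ℂ H] [CompleteSpace H]
    (ρ : H →L[ℂ] H) : Prop :=
  ρ.IsPositive ∧ HasTrace ρ 1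

/-- A projective measurement: orthogonal projections indexed by the outcomes, summing to one. -/
def IsProjectiveMeasurement {O H : Type} [Fintype O] [NormedAddCommGroup H]
    [InnerProductSpace ℂ H] [CompleteSpace H] (M : O → H →L[ℂ] H) : Prop :=
  (∀ o, IsStarProjection (M o)) ∧ ∑ o, M o = 1

/-- Conditional probabilities of the form `P(ab|xy) = Tr[ρ (Π_{a|x} ⊗ Π_{b|y})]`, with no
restriction on the dimensions of the two Hilbert spaces. -/
def IsQuantumCorrelation (r : Table A B X Y) : Prop :=
  ∃ (HA HB : Type) (_ : NormedAddCommGroup HA) (_ : InnerProductSpace ℂ HA)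
    (_ : CompleteSpace HA) (_ : NormedAddCommGroup HB) (_ : InnerProductSpace ℂ HB)
    (_ : CompleteSpace HB)
    (ρ : HilbertTensor HA HB →L[ℂ] HilbertTensor HA HB)
    (MA : X → A → HA →L[ℂ] HA) (MB : Y → B → HB →L[ℂ] HB),
    IsDensityOperator ρ ∧
    (∀ x, IsProjectiveMeasurement (MA x)) ∧ (∀ y, IsProjectiveMeasurement (MB y)) ∧
    ∀ a b x y, HasTrace (ρ ∘L tensorOp (MA x a) (MB y b)) (r a b x y : ℂ)

/-- Distributions `P(abxy) = (∫ dλ w(λ) Tr[ρ(λ) (Π_{a|x}(λ) ⊗ Π_{b|y}(λ))]) P(xy)`. -/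
def quantumSet (A B X Y : Type) [Fintype A] [Fintype B] [Fintype X] [Fintype Y] :
    Set (Table A B X Y) :=
  {p | p ∈ probSpace A B X Y ∧
    ∃ r ∈ hiddenAverages {r : Table A B X Y | IsQuantumCorrelation r},
      ∀ a b x y, p a b x y = r a b x y * inputProb p x y}

end General

/-! ### Single runs and blocks of `N` runs with two inputs and two outputs per party -/

/-- `N`-tuples of bits: the inputs or outputs of one party in a block of `N` runs. -/
abbrev Bits (N : ℕ) := Fin N → Fin 2

/-- Tables for a single run. -/
abbrev Table1 := Table (Fin 2) (Fin 2) (Fin 2) (Fin 2)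

/-- Tables for a block of `N` runs. -/
abbrev TableN (N : ℕ) := Table (Bits N) (Bits N) (Bits N) (Bits N)

/-- The slice `P(xy) = 1/4` of single-run tables. -/
abbrev Uniform1 : Set Table1 := uniformInputs (Fin 2) (Fin 2) (Fin 2) (Fin 2)

/-- The slice `P(xy) = 1/4^N` of block tables. -/
abbrev UniformN (N : ℕ) : Set (TableN N) := uniformInputs (Bits N) (Bits N) (Bits N) (Bits N)

/-- The single-run no-signalling set `NS₁`. -/
abbrev NS1 : Set Table1 := nsSet (Fin 2) (Fin 2) (Fin 2) (Fin 2)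

/-- The single-run quantum set `Q₁`. -/
abbrev Q1 : Set Table1 := quantumSet (Fin 2) (Fin 2) (Fin 2) (Fin 2)

/-- The general block quantum set `Q_N`: coherent states and measurements across the `N` runs. -/
abbrev QN (N : ℕ) : Set (TableN N) := quantumSet (Bits N) (Bits N) (Bits N) (Bits N)

/-- The set `MDL_N`: within a block the outputs of a party may depend on all its inputs, and
`P(xy|λ) ≤ h^N` for input blocks `x`, `y`. -/
abbrev MDL (N : ℕ) (h : ℝ) : Set (TableN N) :=
  mdlSet (Bits N) (Bits N) (Bits N) (Bits N) (h ^ N)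

/-- The product set `NS₁^{×N}`: distributions
`(∫ dλ w(λ) ∏_j P_{q_j(λ)}(a_j b_j | x_j y_j)) P(xy)` with every `q_j(λ)` no-signalling. -/
def NSProd (N : ℕ) : Set (TableN N) :=
  {p | p ∈ probSpace (Bits N) (Bits N) (Bits N) (Bits N) ∧
    ∃ r ∈ hiddenAverages {r : TableN N | ∃ q : Fin N → Table1, (∀ j, q j ∈ NS1) ∧
        ∀ a b x y, r a b x y = ∏ j, condProb (q j) (a j) (b j) (x j) (y j)},
      ∀ a b x y, p a b x y = r a b x y * inputProb p x y}

/-- The coarse-graining `c_N`: the average over the runs `j` of the probability that the inputs and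
outputs of run `j` are `(a, b, x, y)`. -/
def coarseGrain (N : ℕ) (p : TableN N) : Table1 := fun a b x y =>
  (1 / (N : ℝ)) * ∑ j : Fin N, ∑ a' : Bits N, ∑ b' : Bits N, ∑ x' : Bits N, ∑ y' : Bits N,
    if a' j = a ∧ b' j = b ∧ x' j = x ∧ y' j = y then p a' b' x' y' else 0

/-- The Popescu-Rohrlich box with uniform inputs: `P(ab|xy) = 1/2` if `a ⊕ b = xy` and `0`
otherwise, and `P(xy) = 1/4`. -/
def uniformPR : Table1 := fun a b x y => (if a + b = x * y then 1 / 2 else 0) * (1 / 4)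

/-- The distribution produced by the local deterministic strategy `a = f x`, `b = g y` on blocks
together with input probabilities `π(xy)`. -/
def deterministicTable {N : ℕ} (f g : Bits N → Bits N) (π : Bits N → Bits N → ℝ) : TableN N :=
  fun a b x y => (if f x = a ∧ g y = b then 1 else 0) * π x y

/-- The number `k` such that the local deterministic strategy `(f, g)` is a `k`-mismatch strategy
with respect to the coarse-grained distribution `q`: the number of input probabilities `π(xy)` that
have to vanish whenever the coarse-graining of the distribution produced by `(f, g)` and `π` is
compatible with `q`, that is, vanishes wherever `q` does. -/
def mismatchNumber (N : ℕ) (q : Table1) (f g : Bits N → Bits N) : ℕ :=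
  Set.ncard {s : Bits N × Bits N | ∀ π : Bits N → Bits N → ℝ, IsInputDist π →
    (∀ a b x y, q a b x y = 0 → coarseGrain N (deterministicTable f g π) a b x y = 0) →
    π s.1 s.2 = 0}

end BlockMDL

end

noncomputable section

namespace BlockMDL

/-! ### The classical value of two parallel CHSH games -/

/-! Lower bounds on `h` come from zeros. All terms are nonnegative, so neither averaging over the
hidden variable nor coarse-graining can cancel anything: through every event in the support of a
measurement-dependent local block there runs a deterministic strategy that respects all zeros of the
coarse-grained table (`exists_strategy_of_mem_mdlSet`). Its inputs carry total mass one with at most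
`h²` per pair, so at least `1/h²` input pairs must be allowed. For the PR box the allowed pairs are
those on which two parallel CHSH games are both won, at most ten of sixteen (`chsh_block_card_le`).
For a table with the zeros of Hardy's paradox, a strategy through the Hardy event must give up two
pairs, leaving fourteen (`hardy_notMem_coarseGrain_MDL`); a two-qubit state realizes these zeros
(`exists_hardy_correlation`).

Conversely, some strategy wins on exactly ten pairs. Translating its inputs and flipping both
outputs together gives a family whose uniform mixture is two independent PR boxes with uniform
inputs (`blockPower_prTable_eq`), so the bound `1/10` on the inputs suffices. Relabelling covers all
PR vertices, and deterministic vertices need only `1/16`. Uniform no-signalling tables are mixtures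
of these vertices (`exists_vertex_combination`), and coarse-graining is linear and recovers a vertex
from its independent repetition, so all of them are reached once `h² ≥ 1/10`.

Product and quantum blocks are no-signalling between the parties, and at uniform inputs this
survives coarse-graining (`coarseGrain_mem_NS1`), which reduces the statements about them to the
single-run set. -/

theorem chsh_pair_rows_le : ∀ g₀ g₁ g₂ g₃ : Fin 2 × Fin 2,
    let c := fun x a : Fin 2 × Fin 2 =>
      (if a + g₀ = x * (0, 0) then 1 else 0) + (if a + g₁ = x * (0, 1) then 1 else 0)
        + ((if a + g₂ = x * (1, 0) then 1 else 0) + (if a + g₃ = x * (1, 1) then 1 else 0))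
    let m := fun x => max (max (c x (0, 0)) (c x (0, 1))) (max (c x (1, 0)) (c x (1, 1)))
    m (0, 0) + m (0, 1) + (m (1, 0) + m (1, 1)) ≤ 10 := by
  -- For fixed replies of the second party, the first party optimizes each row separately; only the
  -- 256 reply tables remain to be enumerated instead of all pairs of strategies.
  decide +kernel

theorem le_max_pair (c : Fin 2 × Fin 2 → ℕ) (a : Fin 2 × Fin 2) :
    c a ≤ max (max (c (0, 0)) (c (0, 1))) (max (c (1, 0)) (c (1, 1))) := by
  obtain ⟨i, j⟩ := a
  fin_cases i <;> fin_cases j <;> simp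

theorem chsh_pair_card_le (F G : Fin 2 × Fin 2 → Fin 2 × Fin 2) :
    (Finset.univ.filter fun s : (Fin 2 × Fin 2) × (Fin 2 × Fin 2) =>
      F s.1 + G s.2 = s.1 * s.2).card ≤ 10 := by
  have h := chsh_pair_rows_le (G (0, 0)) (G (0, 1)) (G (1, 0)) (G (1, 1))
  rw [Finset.card_filter, Fintype.sum_prod_type]
  simp only [Fintype.sum_prod_type, Fin.sum_univ_two]
  refine le_trans ?_ h
  refine Nat.add_le_add (Nat.add_le_add ?_ ?_) (Nat.add_le_add ?_ ?_) <;>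
    exact le_max_pair (fun a =>
      (if a + G (0, 0) = _ * (0, 0) then 1 else 0) + (if a + G (0, 1) = _ * (0, 1) then 1 else 0)
        + ((if a + G (1, 0) = _ * (1, 0) then 1 else 0)
          + (if a + G (1, 1) = _ * (1, 1) then 1 else 0))) (F _)

/-- A deterministic strategy wins two parallel CHSH games on at most ten of the sixteen inputs. -/
theorem chsh_block_card_le (f g : Bits 2 → Bits 2) :
    (Finset.univ.filter fun s : Bits 2 × Bits 2 => f s.1 + g s.2 = s.1 * s.2).card ≤ 10 := by
  let e : Bits 2 ≃ Fin 2 × Fin 2 := finTwoArrowEquiv (Fin 2)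
  refine le_trans ?_ (chsh_pair_card_le (fun x => e (f (e.symm x))) fun y => e (g (e.symm y)))
  refine Finset.card_le_card_of_injOn (fun s => (e s.1, e s.2)) ?_ ?_
  · intro s hs
    simp only [Finset.coe_filter, Finset.mem_univ, true_and, Set.mem_ofPred_eq,
      Equiv.symm_apply_apply] at hs ⊢
    have h0 := congrFun hs 0
    have h1 := congrFun hs 1
    exact Prod.ext h0 h1
  · intro s _ t _ h
    simp only [Prod.mk.injEq, EmbeddingLike.apply_eq_iff_eq] at h
    exact Prod.ext h.1 h.2

/-! ### Supports of coarse-grainings and of hidden-variable averages -/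

/-- Without negative terms nothing cancels, so zeros of the coarse-graining constrain every run of
every block event in the support. -/
theorem coarseGrain_ne_zero {N : ℕ} {p : TableN N} (hp : ∀ a b x y, 0 ≤ p a b x y)
    {a b x y : Bits N} (h : p a b x y ≠ 0) (j : Fin N) :
    coarseGrain N p (a j) (b j) (x j) (y j) ≠ 0 := by
  have hN : (0 : ℝ) < N := by exact_mod_cast j.pos
  have hpos : 0 < p a b x y := lt_of_le_of_ne (hp a b x y) h.symm
  have hite : ∀ (c : Prop) [Decidable c] (a' b' x' y' : Bits N),
      0 ≤ if c then p a' b' x' y' else 0 := by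
    intro c _ a' b' x' y'
    split
    · exact hp _ _ _ _
    · exact le_rfl
  refine ne_of_gt (mul_pos (by positivity) ?_)
  refine Finset.sum_pos' (fun i _ => ?_) ⟨j, Finset.mem_univ _, ?_⟩
  · exact Finset.sum_nonneg fun _ _ => Finset.sum_nonneg fun _ _ => Finset.sum_nonneg fun _ _ =>
      Finset.sum_nonneg fun _ _ => hite _ _ _ _ _
  refine Finset.sum_pos' (fun i _ => ?_) ⟨a, Finset.mem_univ _, ?_⟩
  · exact Finset.sum_nonneg fun _ _ => Finset.sum_nonneg fun _ _ =>
      Finset.sum_nonneg fun _ _ => hite _ _ _ _ _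
  refine Finset.sum_pos' (fun i _ => ?_) ⟨b, Finset.mem_univ _, ?_⟩
  · exact Finset.sum_nonneg fun _ _ => Finset.sum_nonneg fun _ _ => hite _ _ _ _ _
  refine Finset.sum_pos' (fun i _ => ?_) ⟨x, Finset.mem_univ _, ?_⟩
  · exact Finset.sum_nonneg fun _ _ => hite _ _ _ _ _
  refine Finset.sum_pos' (fun i _ => hite _ _ _ _ _) ⟨y, Finset.mem_univ _, ?_⟩
  simpa using hpos

theorem coarseGrain_ne_zero_exists {N : ℕ} {p : TableN N} {a b x y : Fin 2}
    (h : coarseGrain N p a b x y ≠ 0) :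
    ∃ (j : Fin N) (a' b' x' y' : Bits N),
      a' j = a ∧ b' j = b ∧ x' j = x ∧ y' j = y ∧ p a' b' x' y' ≠ 0 := by
  obtain ⟨j, -, h⟩ := Finset.exists_ne_zero_of_sum_ne_zero (right_ne_zero_of_mul h)
  obtain ⟨a', -, h⟩ := Finset.exists_ne_zero_of_sum_ne_zero h
  obtain ⟨b', -, h⟩ := Finset.exists_ne_zero_of_sum_ne_zero h
  obtain ⟨x', -, h⟩ := Finset.exists_ne_zero_of_sum_ne_zero h
  obtain ⟨y', -, h⟩ := Finset.exists_ne_zero_of_sum_ne_zero h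
  rw [ne_eq, ite_eq_right_iff, Classical.not_imp] at h
  exact ⟨j, a', b', x', y', h.1.1, h.1.2.1, h.1.2.2.1, h.1.2.2.2, h.2⟩

section General

variable {A B X Y : Type} [Fintype A] [Fintype B] [Fintype X] [Fintype Y]

/-- A nonnegative function with zero integral vanishes almost everywhere, and there are finitely
many entries, so almost every component inherits all zeros of the average. If all of these also
vanished at the given entry, so would the average. -/
theorem exists_component_of_hiddenAverages {S : Set (Table A B X Y)}
    (hS : ∀ r ∈ S, ∀ a b x y, 0 ≤ r a b x y) {p : Table A B X Y} (hp : p ∈ hiddenAverages S)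
    {a : A} {b : B} {x : X} {y : Y} (h : p a b x y ≠ 0) :
    ∃ r ∈ S, r a b x y ≠ 0 ∧ ∀ a' b' x' y', p a' b' x' y' = 0 → r a' b' x' y' = 0 := by
  obtain ⟨Λ, _, w, _, r, hrS, hint, hpr⟩ := hp
  have hae : ∀ᵐ l ∂w, ∀ a' b' x' y', p a' b' x' y' = 0 → r l a' b' x' y' = 0 := by
    simp only [ae_all_iff]
    intro a' b' x' y' h0
    rw [hpr] at h0
    exact (integral_eq_zero_iff_of_nonneg (fun l => hS _ (hrS l) _ _ _ _) (hint _ _ _ _)).1 h0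
  by_contra hcon
  push Not at hcon
  refine h ?_
  rw [hpr]
  refine integral_eq_zero_of_ae ?_
  filter_upwards [hae] with l hl
  by_contra hne
  obtain ⟨a', b', x', y', h0, h1⟩ := hcon (r l) (hrS l) hne
  exact h1 (hl _ _ _ _ h0)

/-- The measurement-dependent product tables with input probabilities at most `H`. -/
def productTables (A B X Y : Type) [Fintype A] [Fintype B] [Fintype X] [Fintype Y] (H : ℝ) :
    Set (Table A B X Y) :=
  {r | ∃ (PA : A → X → ℝ) (PB : B → Y → ℝ) (PXY : X → Y → ℝ),
    IsCondDist PA ∧ IsCondDist PB ∧ IsInputDist PXY ∧ (∀ x y, PXY x y ≤ H) ∧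
    ∀ a b x y, r a b x y = PA a x * PB b y * PXY x y}

theorem IsCondDist.exists_ne_zero {O I : Type} [Fintype O] {P : O → I → ℝ} (hP : IsCondDist P)
    (i : I) : ∃ o, P o i ≠ 0 := by
  obtain ⟨o, -, ho⟩ := Finset.exists_ne_zero_of_sum_ne_zero
    (s := Finset.univ) (f := fun o => P o i) (by rw [hP.2 i]; exact one_ne_zero)
  exact ⟨o, ho⟩

theorem IsCondDist.exists_section {O I : Type} [Fintype O] {P : O → I → ℝ} (hP : IsCondDist P)
    {o : O} {i : I} (h : P o i ≠ 0) : ∃ f : I → O, f i = o ∧ ∀ i', P (f i') i' ≠ 0 := by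
  classical
  choose f hf using hP.exists_ne_zero
  refine ⟨Function.update f i o, Function.update_self .., fun i' => ?_⟩
  by_cases hi : i' = i
  · subst hi; simpa using h
  · simpa [hi] using hf i'

/-- The counting bound that turns a small set of admissible inputs into a lower bound on the cap
`H`. -/
theorem IsInputDist.one_le_card_mul {π : X → Y → ℝ} (hπ : IsInputDist π) {H : ℝ}
    (hH : ∀ x y, π x y ≤ H) (s : Finset (X × Y)) (hs : ∀ x y, π x y ≠ 0 → (x, y) ∈ s) :
    1 ≤ s.card * H := by
  classical
  calc (1 : ℝ) = ∑ t : X × Y, π t.1 t.2 := by rw [Fintype.sum_prod_type]; exact hπ.2.symm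
    _ = ∑ t ∈ s, π t.1 t.2 := by
      refine (Finset.sum_subset (Finset.subset_univ s) fun t _ ht => ?_).symm
      by_contra hne
      exact ht (hs _ _ hne)
    _ ≤ ∑ _t ∈ s, H := Finset.sum_le_sum fun t _ => hH _ _
    _ = s.card * H := by rw [Finset.sum_const, nsmul_eq_mul]

/-- A measurement-dependent local distribution contains, for each point of its support, a
deterministic strategy through that point all of whose events lie in the support. -/
theorem exists_strategy_of_mem_mdlSet {H : ℝ} {p : Table A B X Y} (hp : p ∈ mdlSet A B X Y H)
    {a : A} {b : B} {x : X} {y : Y} (h : p a b x y ≠ 0) :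
    ∃ (f : X → A) (g : Y → B) (π : X → Y → ℝ), f x = a ∧ g y = b ∧ π x y ≠ 0 ∧ IsInputDist π ∧
      (∀ x y, π x y ≤ H) ∧ ∀ x' y', π x' y' ≠ 0 → p (f x') (g y') x' y' ≠ 0 := by
  have hnn : ∀ r ∈ productTables A B X Y H, ∀ a b x y, 0 ≤ r a b x y := by
    rintro r ⟨PA, PB, PXY, hA, hB, hXY, -, hr⟩ a b x y
    rw [hr]
    exact mul_nonneg (mul_nonneg (hA.1 _ _) (hB.1 _ _)) (hXY.1 _ _)
  obtain ⟨r, ⟨PA, PB, π, hA, hB, hπ, hH, hr⟩, hne, hsub⟩ :=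
    exists_component_of_hiddenAverages (S := productTables A B X Y H) hnn hp.2 h
  rw [hr] at hne
  obtain ⟨f, hfx, hf⟩ := hA.exists_section (left_ne_zero_of_mul (left_ne_zero_of_mul hne))
  obtain ⟨g, hgy, hg⟩ := hB.exists_section (right_ne_zero_of_mul (left_ne_zero_of_mul hne))
  refine ⟨f, g, π, hfx, hgy, right_ne_zero_of_mul hne, hπ, hH, fun x' y' hne' h0 => ?_⟩
  have := hsub _ _ _ _ h0
  rw [hr] at this
  exact mul_ne_zero (mul_ne_zero (hf x') (hg y')) hne' this

end General

/-! ### The uniform PR box -/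

theorem uniformPR_eq_zero_iff {a b x y : Fin 2} : uniformPR a b x y = 0 ↔ a + b ≠ x * y := by
  unfold uniformPR
  split_ifs with h <;> simp [h]

theorem six_le_mismatchNumber (f g : Bits 2 → Bits 2) :
    6 ≤ mismatchNumber 2 uniformPR f g := by
  classical
  -- Losing either game on an input pair produces an event outside the PR support, which forces that
  -- input probability to vanish; at least `16 - 10` pairs are lost.
  have hsub : (↑(Finset.univ.filter fun s : Bits 2 × Bits 2 => ¬ f s.1 + g s.2 = s.1 * s.2) :
      Set (Bits 2 × Bits 2)) ⊆ {s | ∀ π : Bits 2 → Bits 2 → ℝ, IsInputDist π →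
    (∀ a b x y, uniformPR a b x y = 0 → coarseGrain 2 (deterministicTable f g π) a b x y = 0) →
    π s.1 s.2 = 0} := by
    intro s hs π hπ h
    simp only [Finset.coe_filter, Finset.mem_univ, true_and, Set.mem_ofPred_eq] at hs
    obtain ⟨j, hj⟩ := Function.ne_iff.1 hs
    by_contra hne
    refine coarseGrain_ne_zero (p := deterministicTable f g π) (a := f s.1) (b := g s.2)
      (x := s.1) (y := s.2) (fun a b x y => ?_) (by simpa [deterministicTable] using hne) j
      (h _ _ _ _ (uniformPR_eq_zero_iff.2 hj))
    exact mul_nonneg (by split_ifs <;> norm_num) (hπ.1 _ _)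
  have hle := Set.ncard_le_ncard hsub (Set.toFinite _)
  rw [Set.ncard_coe_finset] at hle
  refine le_trans ?_ hle
  have h1 := chsh_block_card_le f g
  have h2 := Finset.card_filter_add_card_filter_not (s := (Finset.univ : Finset (Bits 2 × Bits 2)))
    (fun s => f s.1 + g s.2 = s.1 * s.2)
  have h3 : (Finset.univ : Finset (Bits 2 × Bits 2)).card = 16 := by simp
  omega

theorem sq_mul_lt_one {h : ℝ} (h0 : 0 ≤ h) {n : ℝ} (hn : 0 < n) (hlt : h < 1 / Real.sqrt n) :
    n * h ^ 2 < 1 := by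
  have hs : 0 < Real.sqrt n := Real.sqrt_pos.2 hn
  have h1 : h * Real.sqrt n < 1 := by rwa [lt_div_iff₀ hs] at hlt
  have h2 : (h * Real.sqrt n) ^ 2 < 1 := by
    have : 0 ≤ h * Real.sqrt n := by positivity
    nlinarith
  rwa [mul_pow, Real.sq_sqrt hn.le, mul_comm] at h2

theorem uniformPR_notMem_coarseGrain_MDL {h : ℝ} (h0 : 0 ≤ h) (hlt : h < 1 / Real.sqrt 10) :
    uniformPR ∉ coarseGrain 2 '' MDL 2 h := by
  rintro ⟨p, hp, hc⟩
  have hne : uniformPR 0 0 0 0 ≠ 0 := by simp [uniformPR]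
  rw [← hc] at hne
  obtain ⟨-, a, b, x, y, -, -, -, -, hne⟩ := coarseGrain_ne_zero_exists hne
  obtain ⟨f, g, π, -, -, -, hπ, hH, hsup⟩ := exists_strategy_of_mem_mdlSet hp hne
  have h1 := hπ.one_le_card_mul hH
    (Finset.univ.filter fun s : Bits 2 × Bits 2 => f s.1 + g s.2 = s.1 * s.2) (by
      intro x y hxy
      simp only [Finset.mem_filter, Finset.mem_univ, true_and]
      ext j : 1
      have := coarseGrain_ne_zero hp.1.1 (hsup x y hxy) j
      rw [hc, ne_eq, uniformPR_eq_zero_iff, not_not] at this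
      exact this)
  have h2 : ((Finset.univ.filter fun s : Bits 2 × Bits 2 =>
      f s.1 + g s.2 = s.1 * s.2).card : ℝ) ≤ 10 := by exact_mod_cast chsh_block_card_le f g
  have h3 := sq_mul_lt_one h0 (by norm_num) hlt
  nlinarith [sq_nonneg h]

/-! ### Hardy-type tables -/

/-- A table with the zeros of Hardy's paradox and a nonzero Hardy event needs input probabilities
of at least `1/14`. -/
theorem hardy_notMem_coarseGrain_MDL {h : ℝ} (h0 : 0 ≤ h) (hlt : h < 1 / Real.sqrt 14)
    {q : Table1} (hq : q 0 0 0 0 ≠ 0) (hq01 : q 0 0 0 1 = 0) (hq10 : q 0 0 1 0 = 0)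
    (hq11 : q 1 1 1 1 = 0) : q ∉ coarseGrain 2 '' MDL 2 h := by
  classical
  rintro ⟨p, hp, hc⟩
  rw [← hc] at hq
  obtain ⟨j, a, b, x, y, ha, hb, hx, hy, hne⟩ := coarseGrain_ne_zero_exists hq
  obtain ⟨f, g, π, hf, hg, -, hπ, hH, hsup⟩ := exists_strategy_of_mem_mdlSet hp hne
  -- Hardy's argument at run `j`: the strategy outputs `0`, `0` at `x`, `y`. The first two zeros
  -- then force output `1` at `y'` and at `x'`, which the third zero forbids.
  have key : ∀ x' y' : Bits 2, x' j = 1 → y' j = 1 →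
      π x y' = 0 ∨ π x' y = 0 ∨ π x' y' = 0 := by
    intro x' y' hx' hy'
    by_contra hcon
    push Not at hcon
    have e1 := coarseGrain_ne_zero hp.1.1 (hsup _ _ hcon.1) j
    have e2 := coarseGrain_ne_zero hp.1.1 (hsup _ _ hcon.2.1) j
    have e3 := coarseGrain_ne_zero hp.1.1 (hsup _ _ hcon.2.2) j
    have two : ∀ t : Fin 2, t ≠ 0 → t = 1 := by decide
    rw [hc, hf, ha, hx, hy'] at e1
    rw [hc, hg, hb, hy, hx'] at e2
    rw [hc, hx', hy', two (g y' j) (fun h => e1 (h ▸ hq01)),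
      two (f x' j) (fun h => e2 (h ▸ hq10))] at e3
    exact e3 hq11
  -- The free bit of the other run gives two copies of Hardy's argument. They involve disjoint sets
  -- of input pairs, so the two vanishing probabilities they yield are at distinct pairs.
  obtain ⟨u, huj, hu⟩ : ∃ u : Fin 2 → Bits 2, (∀ i, u i j = 1) ∧ u 0 ≠ u 1 := by
    refine ⟨fun i => Function.update (fun _ => i) j 1, fun i => by simp, ?_⟩
    obtain ⟨k, hk⟩ := exists_ne j
    exact fun h => by simpa [hk] using congrFun h k
  have hxu : ∀ i, x ≠ u i := fun i h => by simpa [hx, huj] using congrFun h j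
  have hyu : ∀ i, y ≠ u i := fun i h => by simpa [hy, huj] using congrFun h j
  have hpair : ∃ s t : Bits 2 × Bits 2, s ≠ t ∧ π s.1 s.2 = 0 ∧ π t.1 t.2 = 0 := by
    rcases key (u 0) (u 0) (huj 0) (huj 0) with h | h | h <;>
    rcases key (u 1) (u 1) (huj 1) (huj 1) with h' | h' | h' <;>
    refine ⟨(_, _), (_, _), ?_, h, h'⟩ <;>
    simp [hu, hxu, hyu, (hxu _).symm, (hyu _).symm]
  obtain ⟨s, t, hst, hs, ht⟩ := hpair
  have h1 := hπ.one_le_card_mul hH (Finset.univ \ {s, t}) (by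
    intro x y hxy
    simp only [Finset.mem_sdiff, Finset.mem_univ, Finset.mem_insert, Finset.mem_singleton,
      true_and, not_or]
    exact ⟨fun e => hxy (by rw [← e] at hs; exact hs), fun e => hxy (by rw [← e] at ht; exact ht)⟩)
  have h2 : (Finset.univ \ {s, t} : Finset (Bits 2 × Bits 2)).card = 14 := by
    rw [Finset.card_sdiff_of_subset (Finset.subset_univ _), Finset.card_pair hst]
    simp
  rw [h2] at h1
  have h3 := sq_mul_lt_one h0 (by norm_num) hlt
  norm_num at h1
  linarith

/-! ### Coarse-grainings of no-signalling blocks -/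

/-- Half of all bit strings have a prescribed bit at a given position. -/
theorem sum_ite_bit {N : ℕ} (j : Fin N) (c : Fin 2) :
    (∑ y : Bits N, if y j = c then (1 : ℝ) else 0) = 2 ^ N / 2 := by
  have hshift : ∀ c c' : Fin 2, (∑ y : Bits N, if y j = c then (1 : ℝ) else 0) =
      ∑ y : Bits N, if y j = c' then (1 : ℝ) else 0 := by
    intro c c'
    -- Translation by a constant string exchanges the two values of the bit, so both classes have
    -- the same size.
    refine Fintype.sum_equiv (Equiv.addRight fun _ => c' - c) _ _ fun y => ?_
    simp only [Equiv.coe_addRight, Pi.add_apply]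
    congr 1
    rw [eq_iff_iff, ← eq_sub_iff_add_eq, sub_sub_cancel]
  have htot : ∑ c : Fin 2, (∑ y : Bits N, if y j = c then (1 : ℝ) else 0) = 2 ^ N := by
    rw [Finset.sum_comm]
    simp
  rw [Fin.sum_univ_two, hshift 1 c, hshift 0 c] at htot
  linarith

section Sums

variable {A B X Y : Type} [Fintype A] [Fintype B] [Fintype X] [Fintype Y]

theorem sum_swap_parties (F : A → B → X → Y → ℝ) :
    ∑ b, ∑ a, ∑ y, ∑ x, F a b x y = ∑ a, ∑ b, ∑ x, ∑ y, F a b x y := by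
  rw [Finset.sum_comm]
  exact Finset.sum_congr rfl fun a _ => Finset.sum_congr rfl fun b _ => Finset.sum_comm

theorem sum_swap_inputs (F : A → B → X → Y → ℝ) :
    ∑ a, ∑ b, ∑ x, ∑ y, F a b x y = ∑ x, ∑ y, ∑ a, ∑ b, F a b x y := by
  calc ∑ a, ∑ b, ∑ x, ∑ y, F a b x y
      = ∑ s : A × B, ∑ t : X × Y, F s.1 s.2 t.1 t.2 := by
        simp only [Fintype.sum_prod_type]
    _ = ∑ t : X × Y, ∑ s : A × B, F s.1 s.2 t.1 t.2 := Finset.sum_comm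
    _ = _ := by simp only [Fintype.sum_prod_type]

end Sums

/-- Exchanging the parties lets one no-signalling condition be deduced from the other. -/
theorem coarseGrain_swap {N : ℕ} (p : TableN N) (a b x y : Fin 2) :
    coarseGrain N (fun b a y x => p a b x y) b a y x = coarseGrain N p a b x y := by
  refine congrArg (1 / (N : ℝ) * ·) (Finset.sum_congr rfl fun j _ => ?_)
  have h := sum_swap_parties fun a' b' x' y' : Bits N =>
    if b' j = b ∧ a' j = a ∧ y' j = y ∧ x' j = x then p a' b' x' y' else 0
  refine h.trans ?_
  simp only [and_comm, and_left_comm]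

theorem coarseGrain_eq {N : ℕ} (p : TableN N) (a b x y : Fin 2) :
    coarseGrain N p a b x y = (1 / (N : ℝ)) * ∑ j : Fin N, ∑ x' : Bits N, ∑ y' : Bits N,
      (if x' j = x then 1 else 0) * ((if y' j = y then 1 else 0) *
        ∑ a' : Bits N, (if a' j = a then 1 else 0) *
          ∑ b' : Bits N, (if b' j = b then 1 else 0) * p a' b' x' y') := by
  unfold coarseGrain
  congr 1
  refine Finset.sum_congr rfl fun j _ => ?_
  rw [sum_swap_inputs]
  simp only [Finset.mul_sum]
  refine Finset.sum_congr rfl fun x' _ => Finset.sum_congr rfl fun y' _ =>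
    Finset.sum_congr rfl fun a' _ => Finset.sum_congr rfl fun b' _ => ?_
  by_cases h1 : a' j = a <;> by_cases h2 : b' j = b <;> by_cases h3 : x' j = x <;>
    by_cases h4 : y' j = y <;> simp [h1, h2, h3, h4]

theorem sum_ite_bit_mul {N : ℕ} (j : Fin N) (F : Bits N → ℝ) :
    ∑ b, ∑ b' : Bits N, (if b' j = b then 1 else 0) * F b' = ∑ b', F b' := by
  rw [Finset.sum_comm]
  exact Finset.sum_congr rfl fun b' _ => by rw [← Finset.sum_mul]; simp

/-- Summing a coarse-graining over the second output. -/
theorem sum_coarseGrain {N : ℕ} (p : TableN N) (a x y : Fin 2) :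
    ∑ b, coarseGrain N p a b x y = (1 / (N : ℝ)) * ∑ j : Fin N, ∑ x' : Bits N, ∑ y' : Bits N,
      (if x' j = x then 1 else 0) * ((if y' j = y then 1 else 0) *
        ∑ a' : Bits N, (if a' j = a then 1 else 0) * ∑ b' : Bits N, p a' b' x' y') := by
  simp only [coarseGrain_eq]
  rw [← Finset.mul_sum, Finset.sum_comm]
  congr 1
  refine Finset.sum_congr rfl fun j _ => ?_
  rw [Finset.sum_comm]
  refine Finset.sum_congr rfl fun x' _ => ?_
  rw [Finset.sum_comm]
  refine Finset.sum_congr rfl fun y' _ => ?_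
  rw [← Finset.mul_sum, ← Finset.mul_sum, Finset.sum_comm]
  congr 2
  refine Finset.sum_congr rfl fun a' _ => ?_
  rw [← Finset.mul_sum, sum_ite_bit_mul]

theorem inputProb_coarseGrain {N : ℕ} (p : TableN N) (x y : Fin 2) :
    inputProb (coarseGrain N p) x y = (1 / (N : ℝ)) * ∑ j : Fin N, ∑ x' : Bits N, ∑ y' : Bits N,
      (if x' j = x then 1 else 0) * ((if y' j = y then 1 else 0) * inputProb p x' y') := by
  unfold inputProb
  simp only [sum_coarseGrain]
  rw [← Finset.mul_sum, Finset.sum_comm]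
  congr 1
  refine Finset.sum_congr rfl fun j _ => ?_
  rw [Finset.sum_comm]
  refine Finset.sum_congr rfl fun x' _ => ?_
  rw [Finset.sum_comm]
  refine Finset.sum_congr rfl fun y' _ => ?_
  rw [← Finset.mul_sum, ← Finset.mul_sum, sum_ite_bit_mul]

theorem coarseGrain_mem_uniform {N : ℕ} (hN : 1 ≤ N) {p : TableN N} (hp : p ∈ UniformN N) :
    coarseGrain N p ∈ Uniform1 := by
  intro x y
  have hN' : (N : ℝ) ≠ 0 := by positivity
  rw [inputProb_coarseGrain]
  simp only [hp _ _, ← Finset.mul_sum, ← Finset.sum_mul, sum_ite_bit]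
  simp only [Finset.sum_const, Finset.card_univ, Fintype.card_fin, Fintype.card_pi, nsmul_eq_mul,
    Finset.prod_const]
  push_cast
  field_simp

theorem coarseGrain_nonneg {N : ℕ} {p : TableN N} (hp : ∀ a b x y, 0 ≤ p a b x y)
    (a b x y : Fin 2) : 0 ≤ coarseGrain N p a b x y := by
  refine mul_nonneg (by positivity) (Finset.sum_nonneg fun _ _ => Finset.sum_nonneg fun _ _ =>
    Finset.sum_nonneg fun _ _ => Finset.sum_nonneg fun _ _ => Finset.sum_nonneg fun _ _ => ?_)
  split_ifs
  · exact hp _ _ _ _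
  · exact le_rfl

section General

variable {A B X Y : Type} [Fintype A] [Fintype B] [Fintype X] [Fintype Y]

theorem mem_probSpace_of_uniform [Nonempty X] [Nonempty Y] {p : Table A B X Y}
    (h0 : ∀ a b x y, 0 ≤ p a b x y) (hp : p ∈ uniformInputs A B X Y) : p ∈ probSpace A B X Y := by
  refine ⟨h0, ?_⟩
  rw [sum_swap_inputs]
  have : ∀ x y, ∑ a, ∑ b, p a b x y = 1 / ((Fintype.card X : ℝ) * (Fintype.card Y : ℝ)) := hp
  simp only [this, Finset.sum_const, Finset.card_univ, nsmul_eq_mul]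
  field_simp

theorem condProb_of_uniform {p : Table A B X Y} (hp : p ∈ uniformInputs A B X Y) (a : A) (b : B)
    (x : X) (y : Y) :
    condProb p a b x y = ((Fintype.card X : ℝ) * (Fintype.card Y : ℝ)) * p a b x y := by
  rw [condProb, hp]
  rw [div_eq_mul_inv, one_div, inv_inv, mul_comm]

/-- On the uniform slice the no-signalling conditions may be imposed on the joint probabilities. -/
theorem noSignalling_condProb_iff [Nonempty X] [Nonempty Y] {p : Table A B X Y}
    (hp : p ∈ uniformInputs A B X Y) : NoSignalling (condProb p) ↔ NoSignalling p := by
  have hc : ((Fintype.card X : ℝ) * (Fintype.card Y : ℝ)) ≠ 0 := by positivity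
  simp only [NoSignalling, condProb_of_uniform hp, ← Finset.mul_sum, mul_right_inj' hc]

end General

/-- The marginal of a block does not depend on the whole string `y'`, so the sum over `y'` only
counts strings with a prescribed bit, and that count is the same for both bits. -/
theorem coarseGrain_sum_eq {N : ℕ} {p : TableN N}
    (hp : ∀ a x y y', ∑ b, p a b x y = ∑ b, p a b x y') (a x y y' : Fin 2) :
    ∑ b, coarseGrain N p a b x y = ∑ b, coarseGrain N p a b x y' := by
  have h : ∀ y, ∑ b, coarseGrain N p a b x y = (1 / (N : ℝ)) * ∑ j : Fin N, ∑ x' : Bits N,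
      (if x' j = x then 1 else 0) * ((2 ^ N / 2) *
        ∑ a' : Bits N, (if a' j = a then 1 else 0) * ∑ b' : Bits N, p a' b' x' 0) := by
    intro y
    rw [sum_coarseGrain]
    simp only [fun a x y => hp a x y 0, ← Finset.mul_sum, ← Finset.sum_mul, sum_ite_bit]
  rw [h, h]

theorem coarseGrain_mem_NS1 {N : ℕ} (hN : 1 ≤ N) {p : TableN N}
    (hp : p ∈ nsSet (Bits N) (Bits N) (Bits N) (Bits N)) (hu : p ∈ UniformN N) :
    coarseGrain N p ∈ NS1 ∩ Uniform1 := by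
  have hcu := coarseGrain_mem_uniform hN hu
  have hns := (noSignalling_condProb_iff hu).1 hp.2
  refine ⟨⟨mem_probSpace_of_uniform (coarseGrain_nonneg hp.1.1) hcu,
    (noSignalling_condProb_iff hcu).2 ⟨coarseGrain_sum_eq hns.1, fun b y x x' => ?_⟩⟩, hcu⟩
  have := coarseGrain_sum_eq (p := fun b a y x => p a b x y)
    (fun b y x x' => hns.2 b y x x') b y x x'
  simpa only [coarseGrain_swap] using this

section General

variable {A B X Y : Type} [Fintype A] [Fintype B]

theorem noSignalling_of_hiddenAverages {S : Set (Table A B X Y)} (hS : ∀ r ∈ S, NoSignalling r)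
    {r : Table A B X Y} (hr : r ∈ hiddenAverages S) : NoSignalling r := by
  obtain ⟨Λ, _, w, _, s, hs, hint, hrs⟩ := hr
  refine ⟨fun a x y y' => ?_, fun b y x x' => ?_⟩
  · simp only [hrs]
    rw [← integral_finsetSum _ fun b _ => hint a b x y,
      ← integral_finsetSum _ fun b _ => hint a b x y']
    exact integral_congr_ae (.of_forall fun l => (hS _ (hs l)).1 a x y y')
  · simp only [hrs]
    rw [← integral_finsetSum _ fun a _ => hint a b x y,
      ← integral_finsetSum _ fun a _ => hint a b x' y]
    exact integral_congr_ae (.of_forall fun l => (hS _ (hs l)).2 b y x x')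

theorem mem_nsSet_of_hiddenAverages [Fintype X] [Fintype Y] [Nonempty X] [Nonempty Y] {S : Set (Table A B X Y)}
    (hS : ∀ r ∈ S, NoSignalling r) {p r : Table A B X Y} (hp : p ∈ probSpace A B X Y)
    (hu : p ∈ uniformInputs A B X Y) (hr : r ∈ hiddenAverages S)
    (hpr : ∀ a b x y, p a b x y = r a b x y * inputProb p x y) : p ∈ nsSet A B X Y := by
  have hns := noSignalling_of_hiddenAverages hS hr
  refine ⟨hp, (noSignalling_condProb_iff hu).2 ⟨fun a x y y' => ?_, fun b y x x' => ?_⟩⟩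
  · simp only [hpr, hu _ _, ← Finset.sum_mul, hns.1 a x y y']
  · simp only [hpr, hu _ _, ← Finset.sum_mul, hns.2 b y x x']

end General

/-- Summing a product over strings factorizes run by run, so the condition is needed only in each
run. -/
theorem noSignalling_prod {N : ℕ} {K : Fin N → Table1} (hK : ∀ j, NoSignalling (K j)) :
    NoSignalling (fun a b x y : Bits N => ∏ j, K j (a j) (b j) (x j) (y j)) := by
  refine ⟨fun a x y y' => ?_, fun b y x x' => ?_⟩
  · rw [← Fintype.prod_sum fun j b => K j (a j) b (x j) (y j),
      ← Fintype.prod_sum fun j b => K j (a j) b (x j) (y' j)]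
    exact Finset.prod_congr rfl fun j _ => (hK j).1 _ _ _ _
  · rw [← Fintype.prod_sum fun j a => K j a (b j) (x j) (y j),
      ← Fintype.prod_sum fun j a => K j a (b j) (x' j) (y j)]
    exact Finset.prod_congr rfl fun j _ => (hK j).2 _ _ _ _

theorem NSProd_subset_nsSet {N : ℕ} {p : TableN N} (hp : p ∈ NSProd N) (hu : p ∈ UniformN N) :
    p ∈ nsSet (Bits N) (Bits N) (Bits N) (Bits N) := by
  obtain ⟨hp, r, hr, hpr⟩ := hp
  refine mem_nsSet_of_hiddenAverages ?_ hp hu hr hpr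
  rintro r ⟨q, hq, hrq⟩
  have : r = fun a b x y => ∏ j, condProb (q j) (a j) (b j) (x j) (y j) := by
    funext a b x y
    exact hrq a b x y
  rw [this]
  exact noSignalling_prod fun j => (hq j).2

/-! ### Quantum correlations are no-signalling -/

section Quantum

variable {HA HB : Type} [NormedAddCommGroup HA] [InnerProductSpace ℂ HA]
    [NormedAddCommGroup HB] [InnerProductSpace ℂ HB]

theorem tensorOp_coe (S : HA →L[ℂ] HA) (T : HB →L[ℂ] HB) (z : HA ⊗[ℂ] HB) :
    tensorOp S T (z : HilbertTensor HA HB) = (TensorProduct.mapL S T z : HA ⊗[ℂ] HB) :=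
  ContinuousLinearMap.completion_apply_coe _ _

/-- The algebraic tensor product is dense in its completion, so identities between bounded operators
can be checked there. -/
theorem tensorOp_ext {S T : HilbertTensor HA HB →L[ℂ] HilbertTensor HA HB}
    (h : ∀ z : HA ⊗[ℂ] HB, S z = T z) : S = T := by
  ext z
  induction z using UniformSpace.Completion.induction_on with
  | hp => exact isClosed_eq S.continuous T.continuous
  | ih z => exact h z

theorem tensorOp_add_right (S : HA →L[ℂ] HA) (T T' : HB →L[ℂ] HB) :
    tensorOp S (T + T') = tensorOp S T + tensorOp S T' :=
  tensorOp_ext fun z => by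
    rw [add_apply, tensorOp_coe, tensorOp_coe, tensorOp_coe,
      TensorProduct.mapL_add_right, add_apply, UniformSpace.Completion.coe_add]

theorem tensorOp_add_left (S S' : HA →L[ℂ] HA) (T : HB →L[ℂ] HB) :
    tensorOp (S + S') T = tensorOp S T + tensorOp S' T :=
  tensorOp_ext fun z => by
    rw [add_apply, tensorOp_coe, tensorOp_coe, tensorOp_coe,
      TensorProduct.mapL_add_left, add_apply, UniformSpace.Completion.coe_add]

theorem tensorOp_zero_right (S : HA →L[ℂ] HA) : tensorOp S (0 : HB →L[ℂ] HB) = 0 :=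
  tensorOp_ext fun z => by
    rw [tensorOp_coe, TensorProduct.mapL_zero_right, zero_apply, zero_apply,
      UniformSpace.Completion.coe_zero]

theorem tensorOp_zero_left (T : HB →L[ℂ] HB) : tensorOp (0 : HA →L[ℂ] HA) T = 0 :=
  tensorOp_ext fun z => by
    rw [tensorOp_coe, TensorProduct.mapL_zero_left, zero_apply, zero_apply,
      UniformSpace.Completion.coe_zero]

theorem tensorOp_sum_right {O : Type} [Fintype O] (S : HA →L[ℂ] HA) (T : O → HB →L[ℂ] HB) :
    ∑ o, tensorOp S (T o) = tensorOp S (∑ o, T o) := by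
  classical
  induction (Finset.univ : Finset O) using Finset.induction_on with
  | empty => simp only [Finset.sum_empty, tensorOp_zero_right]
  | insert o s ho ih => rw [Finset.sum_insert ho, Finset.sum_insert ho, ih, tensorOp_add_right]

theorem tensorOp_sum_left {O : Type} [Fintype O] (S : O → HA →L[ℂ] HA) (T : HB →L[ℂ] HB) :
    ∑ o, tensorOp (S o) T = tensorOp (∑ o, S o) T := by
  classical
  induction (Finset.univ : Finset O) using Finset.induction_on with
  | empty => simp only [Finset.sum_empty, tensorOp_zero_left]
  | insert o s ho ih => rw [Finset.sum_insert ho, Finset.sum_insert ho, ih, tensorOp_add_left]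

end Quantum

section Trace

variable {H : Type} [NormedAddCommGroup H] [InnerProductSpace ℂ H]

theorem HasTrace.sum {O : Type} [Fintype O] {T : O → H →L[ℂ] H} {t : O → ℂ}
    (h : ∀ o, HasTrace (T o) (t o)) : HasTrace (∑ o, T o) (∑ o, t o) := by
  intro ι e
  simp only [sum_apply, inner_sum]
  exact hasSum_sum fun o _ => h o ι e

/-- `HasTrace` quantifies over all Hilbert bases; existence of one excludes vacuous truth. -/
theorem HasTrace.unique [CompleteSpace H] {T : H →L[ℂ] H} {s t : ℂ} (hs : HasTrace T s)
    (ht : HasTrace T t) : s = t := by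
  obtain ⟨w, e, -⟩ := exists_hilbertBasis ℂ H
  exact (hs w e).unique (ht w e)

end Trace

section General

variable {A B X Y : Type} [Fintype A] [Fintype B]

/-- The projections of one party sum to the identity whatever its setting, so the other party's
marginal is the trace of one and the same operator. -/
theorem IsQuantumCorrelation.noSignalling {r : Table A B X Y} (hr : IsQuantumCorrelation r) :
    NoSignalling r := by
  obtain ⟨HA, HB, _, _, _, _, _, _, ρ, MA, MB, -, hA, hB, htr⟩ := hr
  refine ⟨fun a x y y' => ?_, fun b y x x' => ?_⟩
  · have key : ∀ y, HasTrace (ρ ∘L tensorOp (MA x a) 1) (∑ b, r a b x y : ℝ) := by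
      intro y
      have := HasTrace.sum fun b => htr a b x y
      rwa [← ContinuousLinearMap.comp_finsetSum, tensorOp_sum_right, (hB y).2,
        ← Complex.ofReal_sum] at this
    exact_mod_cast (key y).unique (key y')
  · have key : ∀ x, HasTrace (ρ ∘L tensorOp 1 (MB y b)) (∑ a, r a b x y : ℝ) := by
      intro x
      have := HasTrace.sum fun a => htr a b x y
      rwa [← ContinuousLinearMap.comp_finsetSum, tensorOp_sum_left, (hA x).2,
        ← Complex.ofReal_sum] at this
    exact_mod_cast (key x).unique (key x')

end General

theorem QN_subset_nsSet {N : ℕ} {p : TableN N} (hp : p ∈ QN N) (hu : p ∈ UniformN N) :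
    p ∈ nsSet (Bits N) (Bits N) (Bits N) (Bits N) := by
  obtain ⟨hp, r, hr, hpr⟩ := hp
  exact mem_nsSet_of_hiddenAverages (fun r hr => hr.noSignalling) hp hu hr hpr

/-! ### Independent repetitions of a single run -/

/-- The block table of `N` independent runs. -/
def blockPower (N : ℕ) (q : Table1) : TableN N := fun a b x y => ∏ j, q (a j) (b j) (x j) (y j)

theorem sum_blocks_prod {N : ℕ} (G : Fin N → Table1) :
    ∑ a : Bits N, ∑ b : Bits N, ∑ x : Bits N, ∑ y : Bits N, ∏ k, G k (a k) (b k) (x k) (y k) =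
      ∏ k, ∑ a, ∑ b, ∑ x, ∑ y, G k a b x y := by
  simp only [Fintype.prod_sum]

theorem inputProb_blockPower {N : ℕ} (q : Table1) (x y : Bits N) :
    inputProb (blockPower N q) x y = ∏ j, inputProb q (x j) (y j) := by
  simp only [inputProb, blockPower, Fintype.prod_sum]

theorem blockPower_mem_uniform (N : ℕ) {q : Table1} (hq : q ∈ Uniform1) :
    blockPower N q ∈ UniformN N := by
  intro x y
  rw [inputProb_blockPower]
  simp only [hq _ _, Finset.prod_const, Finset.card_univ, Fintype.card_fin, Fintype.card_pi]
  push_cast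
  rw [div_pow, mul_pow, one_pow]

/-- Every run of an independent repetition has marginal `q`: the factors of the other runs sum to
one. This gives preimages under coarse-graining. -/
theorem coarseGrain_blockPower {N : ℕ} (hN : 1 ≤ N) {q : Table1}
    (hq : ∑ a, ∑ b, ∑ x, ∑ y, q a b x y = 1) : coarseGrain N (blockPower N q) = q := by
  funext a b x y
  have key : ∀ j : Fin N, (∑ a' : Bits N, ∑ b' : Bits N, ∑ x' : Bits N, ∑ y' : Bits N,
      if a' j = a ∧ b' j = b ∧ x' j = x ∧ y' j = y then blockPower N q a' b' x' y' else 0) =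
      q a b x y := by
    intro j
    have h1 : ∀ a' b' x' y' : Bits N,
        (if a' j = a ∧ b' j = b ∧ x' j = x ∧ y' j = y then blockPower N q a' b' x' y' else 0) =
        ∏ k, (fun a'' b'' x'' y'' => if k = j → a'' = a ∧ b'' = b ∧ x'' = x ∧ y'' = y
          then q a'' b'' x'' y'' else 0) (a' k) (b' k) (x' k) (y' k) := by
      intro a' b' x' y'
      split_ifs with h
      · refine Finset.prod_congr rfl fun k _ => (if_pos ?_).symm
        rintro rfl
        exact h
      · exact (Finset.prod_eq_zero (Finset.mem_univ j) (if_neg fun h' => h (h' rfl))).symm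
    simp only [h1]
    rw [sum_blocks_prod fun k a'' b'' x'' y'' =>
      if k = j → a'' = a ∧ b'' = b ∧ x'' = x ∧ y'' = y then q a'' b'' x'' y'' else 0]
    rw [Finset.prod_eq_single j]
    · simp [ite_and]
    · intro k _ hk
      simpa only [hk, false_imp_iff, if_true] using hq
    · simp
  unfold coarseGrain
  simp only [key]
  have : (N : ℝ) ≠ 0 := by positivity
  simp
  field_simp

/-- The two-run coarse-graining maps the no-signalling product set onto the no-signalling set. -/
theorem coarseGrain_image_NSProd :
    coarseGrain 2 '' (NSProd 2 ∩ UniformN 2) = NS1 ∩ Uniform1 := by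
  ext q
  constructor
  · rintro ⟨p, ⟨hp, hu⟩, rfl⟩
    exact coarseGrain_mem_NS1 (by norm_num) (NSProd_subset_nsSet hp hu) hu
  · rintro ⟨hq, hu⟩
    have hbu := blockPower_mem_uniform 2 hu
    -- The independent repetition needs no hidden variable, so a one-point space serves.
    refine ⟨blockPower 2 q, ⟨⟨mem_probSpace_of_uniform (fun a b x y =>
      Finset.prod_nonneg fun _ _ => hq.1.1 _ _ _ _) hbu,
      fun a b x y => ∏ j, condProb q (a j) (b j) (x j) (y j),
      ⟨Unit, inferInstance, Measure.dirac (), inferInstance, fun _ a b x y =>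
        ∏ j, condProb q (a j) (b j) (x j) (y j), fun _ => ⟨fun _ => q, fun _ => hq,
          fun _ _ _ _ => rfl⟩, fun _ _ _ _ => integrable_const _, fun _ _ _ _ => by simp⟩, ?_⟩,
      hbu⟩, coarseGrain_blockPower (by norm_num) hq.1.2⟩
    intro a b x y
    rw [inputProb_blockPower, ← Finset.prod_mul_distrib]
    refine Finset.prod_congr rfl fun j _ => ?_
    rw [condProb, div_mul_cancel₀]
    rw [hu]
    simp

/-! ### The vertices of the no-signalling polytope -/

/-- Labels of the sixteen local deterministic and the eight Popescu-Rohrlich vertices. -/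
abbrev Vertex : Type := (Fin 2 × Fin 2 × Fin 2 × Fin 2) ⊕ (Fin 2 × Fin 2 × Fin 2)

/-- The deterministic table `a = αx + γ`, `b = βy + δ` with uniform inputs. -/
def detTable (α γ β δ : Fin 2) : Table1 := fun a b x y =>
  if a = α * x + γ ∧ b = β * y + δ then 1 / 4 else 0

/-- The Popescu-Rohrlich box `a + b = xy + αx + βy + γ` with uniform inputs. -/
def prTable (α β γ : Fin 2) : Table1 := fun a b x y =>
  if a + b = x * y + α * x + β * y + γ then 1 / 8 else 0

/-- The joint distribution of a vertex, with uniform inputs. -/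
def Vertex.table : Vertex → Table1
  | .inl (α, γ, β, δ) => detTable α γ β δ
  | .inr (α, β, γ) => prTable α β γ

theorem Vertex.table_nonneg (v : Vertex) (a b x y : Fin 2) : 0 ≤ v.table a b x y := by
  rcases v with ⟨α, γ, β, δ⟩ | ⟨α, β, γ⟩
  · simp only [Vertex.table, detTable]; split_ifs <;> norm_num
  · simp only [Vertex.table, prTable]; split_ifs <;> norm_num

theorem Vertex.sum_right (v : Vertex) (a x y : Fin 2) :
    ∑ b, v.table a b x y = match v with
      | .inl (α, γ, _, _) => if a = α * x + γ then 1 / 4 else 0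
      | .inr _ => 1 / 8 := by
  rcases v with ⟨α, γ, β, δ⟩ | ⟨α, β, γ⟩
  · simp [Vertex.table, detTable, ite_and]
  · simp only [Vertex.table, prTable, fun b => add_comm a b, ← eq_sub_iff_add_eq,
      Finset.sum_ite_eq', Finset.mem_univ, if_true]

theorem Vertex.sum_left (v : Vertex) (b x y : Fin 2) :
    ∑ a, v.table a b x y = match v with
      | .inl (_, _, β, δ) => if b = β * y + δ then 1 / 4 else 0
      | .inr _ => 1 / 8 := by
  rcases v with ⟨α, γ, β, δ⟩ | ⟨α, β, γ⟩
  · simp [Vertex.table, detTable, ite_and]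
  · simp only [Vertex.table, prTable, ← eq_sub_iff_add_eq,
      Finset.sum_ite_eq', Finset.mem_univ, if_true]

theorem Vertex.noSignalling (v : Vertex) : NoSignalling v.table :=
  ⟨fun a x y y' => by rw [v.sum_right, v.sum_right],
    fun b y x x' => by rw [v.sum_left, v.sum_left]⟩

theorem Vertex.table_mem_uniform (v : Vertex) : v.table ∈ Uniform1 := by
  intro x y
  simp only [inputProb, v.sum_right]
  rcases v with ⟨α, γ, β, δ⟩ | ⟨α, β, γ⟩ <;> simp <;> norm_num

theorem uniformPR_eq_table : uniformPR = Vertex.table (.inr (0, 0, 0)) := by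
  funext a b x y
  simp only [uniformPR, Vertex.table, prTable, zero_mul, add_zero]
  split_ifs <;> norm_num

theorem uniformPR_mem : uniformPR ∈ NS1 ∩ Uniform1 := by
  rw [uniformPR_eq_table]
  have hu := Vertex.table_mem_uniform (.inr (0, 0, 0))
  exact ⟨⟨mem_probSpace_of_uniform (Vertex.table_nonneg _) hu,
    (noSignalling_condProb_iff hu).2 (Vertex.noSignalling _)⟩, hu⟩

/-! ### Supports of no-signalling tables -/

/-- The support of a table at fixed inputs, in the order `00, 01, 10, 11` of the outputs. -/
abbrev Pattern : Type := Bool × Bool × Bool × Bool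

/-- Two supports allow the same first outputs. -/
def Pattern.sameRows (p q : Pattern) : Bool :=
  (p.1 || p.2.1) == (q.1 || q.2.1) && (p.2.2.1 || p.2.2.2) == (q.2.2.1 || q.2.2.2)

/-- Two supports allow the same second outputs. -/
def Pattern.sameCols (p q : Pattern) : Bool :=
  (p.1 || p.2.2.1) == (q.1 || q.2.2.1) && (p.2.1 || p.2.2.2) == (q.2.1 || q.2.2.2)

/-- Membership of a pair of outputs in a support. -/
def Pattern.has (p : Pattern) (a b : Fin 2) : Bool :=
  if a = 0 then if b = 0 then p.1 else p.2.1 else if b = 0 then p.2.2.1 else p.2.2.2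

set_option synthInstance.maxSize 2000 in
set_option synthInstance.maxHeartbeats 400000 in
-- Read the four supports as relations around a 4-cycle, each total and surjective between the
-- outputs that occur. If going once around fixes some output, a deterministic vertex fits.
-- Otherwise the round trip must swap the two outputs, all four relations are permutations, and
-- their odd product is the pattern of a PR box. The proof is enumeration; interleaving hypotheses
-- and quantifiers prunes it.
theorem Pattern.exists_vertex : ∀ p₀₀ : Pattern, p₀₀ ≠ (false, false, false, false) →
    ∀ p₀₁, Pattern.sameRows p₀₀ p₀₁ → ∀ p₁₀, Pattern.sameCols p₀₀ p₁₀ →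
    ∀ p₁₁, Pattern.sameRows p₁₀ p₁₁ → Pattern.sameCols p₀₁ p₁₁ →
    (∃ a₀ b₀ : Fin 2, p₀₀.has a₀ b₀ ∧ ∃ b₁, p₀₁.has a₀ b₁ ∧ ∃ a₁, p₁₀.has a₁ b₀ ∧
      p₁₁.has a₁ b₁) ∨
    (∃ γ : Fin 2, (p₀₀.has 0 γ ∧ p₀₀.has 1 (1 + γ)) ∧
      ∃ β, (p₀₁.has 0 (β + γ) ∧ p₀₁.has 1 (1 + (β + γ))) ∧
      ∃ α, (p₁₀.has 0 (α + γ) ∧ p₁₀.has 1 (1 + (α + γ))) ∧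
        p₁₁.has 0 (1 + α + β + γ) ∧ p₁₁.has 1 (α + β + γ)) := by
  decide +kernel

open Classical in
/-- The support of a table at the inputs `x`, `y`. -/
def supportPattern (P : Table1) (x y : Fin 2) : Pattern :=
  (decide (P 0 0 x y ≠ 0), decide (P 0 1 x y ≠ 0), decide (P 1 0 x y ≠ 0), decide (P 1 1 x y ≠ 0))

theorem supportPattern_has {P : Table1} {a b x y : Fin 2} :
    (supportPattern P x y).has a b = true ↔ P a b x y ≠ 0 := by
  fin_cases a <;> fin_cases b <;> simp [supportPattern, Pattern.has]

theorem decide_or_eq_of_add_eq {s t u v : ℝ} (hs : 0 ≤ s) (ht : 0 ≤ t) (hu : 0 ≤ u) (hv : 0 ≤ v)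
    (h : s + t = u + v) : (s ≠ 0 ∨ t ≠ 0) ↔ (u ≠ 0 ∨ v ≠ 0) := by
  rw [← not_iff_not]
  push Not
  rw [← add_eq_zero_iff_of_nonneg hs ht, ← add_eq_zero_iff_of_nonneg hu hv, h]

theorem supportPattern_sameRows {P : Table1} (h0 : ∀ a b x y, 0 ≤ P a b x y)
    (hP : NoSignalling P) (x y y' : Fin 2) :
    (supportPattern P x y).sameRows (supportPattern P x y') := by
  have h := fun a => hP.1 a x y y'
  simp only [Fin.sum_univ_two] at h
  simp only [Pattern.sameRows, supportPattern, Bool.and_eq_true, beq_iff_eq,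
    ← Bool.decide_or, decide_eq_decide]
  exact ⟨decide_or_eq_of_add_eq (h0 _ _ _ _) (h0 _ _ _ _) (h0 _ _ _ _) (h0 _ _ _ _) (h 0),
    decide_or_eq_of_add_eq (h0 _ _ _ _) (h0 _ _ _ _) (h0 _ _ _ _) (h0 _ _ _ _) (h 1)⟩

theorem supportPattern_sameCols {P : Table1} (h0 : ∀ a b x y, 0 ≤ P a b x y)
    (hP : NoSignalling P) (x x' y : Fin 2) :
    (supportPattern P x y).sameCols (supportPattern P x' y) := by
  have h := fun b => hP.2 b y x x'
  simp only [Fin.sum_univ_two] at h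
  simp only [Pattern.sameCols, supportPattern, Bool.and_eq_true, beq_iff_eq,
    ← Bool.decide_or, decide_eq_decide]
  exact ⟨decide_or_eq_of_add_eq (h0 _ _ _ _) (h0 _ _ _ _) (h0 _ _ _ _) (h0 _ _ _ _) (h 0),
    decide_or_eq_of_add_eq (h0 _ _ _ _) (h0 _ _ _ _) (h0 _ _ _ _) (h0 _ _ _ _) (h 1)⟩

/-- No-signalling makes the total mass the same at all inputs, so a table vanishing at one input
pair vanishes everywhere. -/
theorem supportPattern_ne {P : Table1} (h0 : ∀ a b x y, 0 ≤ P a b x y)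
    (hP : NoSignalling P) (hne : P ≠ 0) :
    supportPattern P 0 0 ≠ (false, false, false, false) := by
  intro h
  simp only [supportPattern, Prod.mk.injEq, decide_eq_false_iff_not, not_not] at h
  refine hne ?_
  funext a b x y
  have hsum : ∑ a, ∑ b, P a b x y = 0 := by
    rw [Finset.sum_congr rfl fun a _ => hP.1 a x y 0, Finset.sum_comm,
      Finset.sum_congr rfl fun b _ => hP.2 b 0 x 0]
    simp [Fin.sum_univ_two, h]
  rw [Finset.sum_eq_zero_iff_of_nonneg fun _ _ => Finset.sum_nonneg fun _ _ => h0 _ _ _ _] at hsum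
  have := hsum a (Finset.mem_univ a)
  rw [Finset.sum_eq_zero_iff_of_nonneg fun _ _ => h0 _ _ _ _] at this
  exact this b (Finset.mem_univ b)

/-- The support of a nonzero no-signalling table contains the support of a vertex. -/
theorem exists_vertex_support {P : Table1} (h0 : ∀ a b x y, 0 ≤ P a b x y)
    (hP : NoSignalling P) (hne : P ≠ 0) :
    ∃ v : Vertex, ∀ a b x y, v.table a b x y ≠ 0 → P a b x y ≠ 0 := by
  rcases Pattern.exists_vertex _ (supportPattern_ne h0 hP hne)
    _ (supportPattern_sameRows h0 hP 0 0 1) _ (supportPattern_sameCols h0 hP 0 1 0)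
    _ (supportPattern_sameRows h0 hP 1 0 1) (supportPattern_sameCols h0 hP 0 1 1) with
    ⟨a₀, b₀, h00, b₁, h01, a₁, h10, h11⟩ | ⟨γ, h00, β, h01, α, h10, h11⟩
  · simp only [supportPattern_has] at h00 h01 h10 h11
    -- Every function of one bit is affine; these coefficients interpolate the chosen outputs.
    refine ⟨.inl (a₁ - a₀, a₀, b₁ - b₀, b₀), fun a b x y h => ?_⟩
    simp only [Vertex.table, detTable, ne_eq, ite_eq_right_iff, Classical.not_imp] at h
    obtain ⟨⟨rfl, rfl⟩, -⟩ := h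
    fin_cases x <;> fin_cases y <;> simp_all
  · simp only [supportPattern_has] at h00 h01 h10 h11
    refine ⟨.inr (α, β, γ), fun a b x y h => ?_⟩
    simp only [Vertex.table, prTable, ne_eq, ite_eq_right_iff, Classical.not_imp] at h
    have hb : b = a + (x * y + α * x + β * y + γ) := by
      rw [← h.1, ← add_assoc]
      have : ∀ a b : Fin 2, b = a + a + b := by decide
      exact this a b
    have h2 : (1 : Fin 2) + (1 + α + β + γ) = α + β + γ :=
      (by decide : ∀ α β γ : Fin 2, 1 + (1 + α + β + γ) = α + β + γ) α β γ
    subst hb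
    fin_cases x <;> fin_cases y <;> fin_cases a <;> simp_all

/-- Nonnegative no-signalling tables are nonnegative combinations of vertices. -/
theorem exists_vertex_combination (n : ℕ) : ∀ P : Table1, (∀ a b x y, 0 ≤ P a b x y) →
    NoSignalling P →
    Set.ncard {s : Fin 2 × Fin 2 × Fin 2 × Fin 2 | P s.1 s.2.1 s.2.2.1 s.2.2.2 ≠ 0} ≤ n →
    ∃ w : Vertex → ℝ, (∀ v, 0 ≤ w v) ∧ P = ∑ v, w v • v.table := by
  classical
  induction n with
  | zero =>
    intro P _ _ hn
    refine ⟨0, fun _ => le_rfl, ?_⟩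
    rw [Nat.le_zero, Set.ncard_eq_zero (Set.toFinite _)] at hn
    simp only [Pi.zero_apply, zero_smul, Finset.sum_const_zero]
    funext a b x y
    by_contra hne
    have : (a, b, x, y) ∈ (∅ : Set (Fin 2 × Fin 2 × Fin 2 × Fin 2)) := hn ▸ hne
    exact this
  | succ n ih =>
    intro P h0 hP hn
    by_cases hz : P = 0
    · exact ⟨0, fun _ => le_rfl, by simp [hz]⟩
    obtain ⟨v, hv⟩ := exists_vertex_support h0 hP hz
    have hvne : (Finset.univ.filter fun s : Fin 2 × Fin 2 × Fin 2 × Fin 2 =>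
        v.table s.1 s.2.1 s.2.2.1 s.2.2.2 ≠ 0).Nonempty := by
      by_contra hemp
      rw [Finset.not_nonempty_iff_eq_empty, Finset.filter_eq_empty_iff] at hemp
      have := v.table_mem_uniform 0 0
      have h' : ∀ a b, v.table a b 0 0 = 0 := fun a b => by
        simpa using hemp (Finset.mem_univ (a, b, 0, 0))
      simp [inputProb, h'] at this
    -- The least ratio is the largest multiple of the vertex that can be subtracted while staying
    -- nonnegative. The entry attaining it becomes zero, so the support strictly shrinks and the
    -- induction applies.
    obtain ⟨s, hs, hmin⟩ := Finset.exists_min_image _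
      (fun s : Fin 2 × Fin 2 × Fin 2 × Fin 2 =>
        P s.1 s.2.1 s.2.2.1 s.2.2.2 / v.table s.1 s.2.1 s.2.2.1 s.2.2.2) hvne
    simp only [Finset.mem_filter, Finset.mem_univ, true_and] at hs hmin
    set t := P s.1 s.2.1 s.2.2.1 s.2.2.2 / v.table s.1 s.2.1 s.2.2.1 s.2.2.2 with ht
    have ht0 : 0 ≤ t := div_nonneg (h0 _ _ _ _) (v.table_nonneg _ _ _ _)
    have hle : ∀ a b x y, t * v.table a b x y ≤ P a b x y := by
      intro a b x y
      by_cases hne : v.table a b x y = 0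
      · rw [hne, mul_zero]; exact h0 _ _ _ _
      · have := hmin (a, b, x, y) hne
        rwa [le_div_iff₀ (lt_of_le_of_ne (v.table_nonneg _ _ _ _) (Ne.symm hne))] at this
    obtain ⟨w, hw, hPw⟩ := ih (P - t • v.table) (fun a b x y => sub_nonneg.2 (hle a b x y))
      ⟨fun a x y y' => by
        simp only [Pi.sub_apply, Pi.smul_apply, smul_eq_mul, Finset.sum_sub_distrib,
          ← Finset.mul_sum, hP.1 a x y y', v.noSignalling.1 a x y y'],
      fun b y x x' => by
        simp only [Pi.sub_apply, Pi.smul_apply, smul_eq_mul, Finset.sum_sub_distrib,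
          ← Finset.mul_sum, hP.2 b y x x', v.noSignalling.2 b y x x']⟩ (by
        refine Nat.lt_succ_iff.1 (lt_of_lt_of_le (Set.ncard_lt_ncard ?_ (Set.toFinite _)) hn)
        refine ⟨fun u hu hPu => hu ?_, fun hsub => hsub (a := s) (hv _ _ _ _ hs) ?_⟩
        · have := hle u.1 u.2.1 u.2.2.1 u.2.2.2
          rw [hPu] at this
          have h' := mul_nonneg ht0 (v.table_nonneg u.1 u.2.1 u.2.2.1 u.2.2.2)
          simp only [Pi.sub_apply, Pi.smul_apply, smul_eq_mul, hPu]
          linarith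
        · simp only [Pi.sub_apply, Pi.smul_apply, smul_eq_mul]
          rw [ht, div_mul_cancel₀ _ hs, sub_self])
    refine ⟨w + Pi.single v t, fun u => add_nonneg (hw u) ?_, ?_⟩
    · rw [Pi.single_apply]
      split_ifs
      exacts [ht0, le_rfl]
    · simp only [Pi.add_apply, add_smul, Finset.sum_add_distrib, ← hPw]
      rw [Finset.sum_eq_single v (fun u _ hu => by simp [Pi.single_eq_of_ne hu]) (by simp)]
      simp

/-! ### Finite mixtures -/

section General

variable {A B X Y : Type}

/-- A finite mixture is an average over a discrete hidden variable weighted by point masses. -/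
theorem convexHull_subset_hiddenAverages (S : Set (Table A B X Y)) :
    convexHull ℝ S ⊆ hiddenAverages S := by
  intro p hp
  obtain ⟨ι, _, w, z, hw0, hw1, hz, rfl⟩ := mem_convexHull_iff_exists_fintype.1 hp
  let _ : MeasurableSpace ι := ⊤
  let μ : Measure ι := ∑ i, ENNReal.ofReal (w i) • Measure.dirac i
  have hμ : IsProbabilityMeasure μ := by
    constructor
    simp only [μ, Measure.coe_finsetSum, Finset.sum_apply, Measure.smul_apply, measure_univ,
      smul_eq_mul, mul_one]
    rw [← ENNReal.ofReal_sum_of_nonneg fun i _ => hw0 i, hw1, ENNReal.ofReal_one]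
  refine ⟨ι, inferInstance, μ, hμ, z, hz, fun a b x y => Integrable.of_finite, fun a b x y => ?_⟩
  have : ∀ i, IsFiniteMeasure (ENNReal.ofReal (w i) • Measure.dirac i) := fun i =>
    Measure.smul_finite _ ENNReal.ofReal_ne_top
  rw [integral_finsetSum_measure fun i _ => Integrable.of_finite]
  simp [integral_smul_measure, hw0, Finset.sum_apply]

theorem nonneg_of_hiddenAverages {S : Set (Table A B X Y)}
    (hS : ∀ r ∈ S, ∀ a b x y, 0 ≤ r a b x y) {p : Table A B X Y} (hp : p ∈ hiddenAverages S)
    (a : A) (b : B) (x : X) (y : Y) : 0 ≤ p a b x y := by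
  obtain ⟨Λ, _, w, _, r, hr, -, hpr⟩ := hp
  rw [hpr]
  exact integral_nonneg fun l => hS _ (hr l) _ _ _ _

end General

theorem convexHull_productTables_subset {N : ℕ} {H : ℝ} :
    convexHull ℝ (productTables (Bits N) (Bits N) (Bits N) (Bits N) H) ∩ UniformN N ⊆
      mdlSet (Bits N) (Bits N) (Bits N) (Bits N) H ∩ UniformN N := by
  rintro p ⟨hp, hu⟩
  have hav := convexHull_subset_hiddenAverages _ hp
  refine ⟨⟨mem_probSpace_of_uniform (nonneg_of_hiddenAverages ?_ hav) hu, hav⟩, hu⟩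
  rintro r ⟨PA, PB, PXY, hA, hB, hXY, -, hr⟩ a b x y
  rw [hr]
  exact mul_nonneg (mul_nonneg (hA.1 _ _) (hB.1 _ _)) (hXY.1 _ _)

theorem coarseGrain_isLinearMap (N : ℕ) : IsLinearMap ℝ (coarseGrain N) where
  map_add p q := by
    funext a b x y
    simp only [Pi.add_apply, coarseGrain_eq, mul_add, Finset.sum_add_distrib]
  map_smul c p := by
    funext a b x y
    simp only [Pi.smul_apply, smul_eq_mul, coarseGrain_eq, Finset.mul_sum]
    refine Finset.sum_congr rfl fun _ _ => Finset.sum_congr rfl fun _ _ =>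
      Finset.sum_congr rfl fun _ _ => Finset.sum_congr rfl fun _ _ =>
      Finset.sum_congr rfl fun _ _ => by ring

theorem convex_uniformN (N : ℕ) : Convex ℝ (UniformN N) := by
  intro p hp q hq s t _ _ hst x y
  have h := hp x y
  have h' := hq x y
  unfold inputProb at h h' ⊢
  simp only [Pi.add_apply, Pi.smul_apply, smul_eq_mul, Finset.sum_add_distrib, ← Finset.mul_sum]
  rw [h, h', ← add_mul, hst, one_mul]

/-! ### Vertices from measurement-dependent local blocks -/

/-- The conditional distribution of a deterministic response function. -/
def response {O I : Type} [DecidableEq O] (f : I → O) : O → I → ℝ := fun o i =>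
  if o = f i then 1 else 0

theorem response_isCondDist {O I : Type} [Fintype O] [DecidableEq O] (f : I → O) :
    IsCondDist (response f) :=
  ⟨fun o i => by unfold response; split_ifs <;> norm_num, fun i => by simp [response]⟩

theorem prod_ite_fin_two {c : ℝ} (p : Fin 2 → Prop) [DecidablePred p] [Decidable (∀ j, p j)] :
    ∏ j, (if p j then c else 0) = if ∀ j, p j then c ^ 2 else 0 := by
  split_ifs with h
  · simp [h]
  · push Not at h
    obtain ⟨j, hj⟩ := h
    exact Finset.prod_eq_zero (Finset.mem_univ j) (if_neg hj)

theorem blockPower_detTable_mem {H : ℝ} (hH : 1 / 16 ≤ H) (α γ β δ : Fin 2) :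
    blockPower 2 (detTable α γ β δ) ∈ productTables (Bits 2) (Bits 2) (Bits 2) (Bits 2) H := by
  refine ⟨response fun x j => α * x j + γ, response fun y j => β * y j + δ, fun _ _ => 1 / 16,
    response_isCondDist _, response_isCondDist _, ⟨fun _ _ => by norm_num, ?_⟩, fun _ _ => hH,
    fun a b x y => ?_⟩
  · simp only [Finset.sum_const, Finset.card_univ, Fintype.card_pi, Fintype.card_fin, nsmul_eq_mul]
    norm_num
  · simp only [blockPower, detTable, response]
    rw [prod_ite_fin_two]
    simp only [forall_and, ← funext_iff]
    split_ifs <;> simp_all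
    norm_num

/-- A strategy of the first party that wins two parallel CHSH games on ten inputs. -/
def winA (x : Bits 2) : Bits 2 := if x = 1 then ![0, 1] else 0

/-- A strategy of the second party that wins two parallel CHSH games on ten inputs. -/
def winB (y : Bits 2) : Bits 2 := if y = 1 then ![1, 0] else 0

/-- The uniform distribution on the ten inputs on which `winA` and `winB` win. -/
def winInputs (x y : Bits 2) : ℝ := if winA x + winB y = x * y then 1 / 10 else 0

theorem win_card : (Finset.univ.filter fun s : Bits 2 × Bits 2 =>
    winA s.1 + winB s.2 = s.1 * s.2).card = 10 := by
  decide +kernel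

theorem winInputs_isInputDist : IsInputDist winInputs := by
  refine ⟨fun x y => by unfold winInputs; split_ifs <;> norm_num, ?_⟩
  rw [← Fintype.sum_prod_type']
  unfold winInputs
  rw [← Finset.sum_filter, Finset.sum_const, win_card]
  norm_num

theorem IsInputDist.shift {X Y : Type} [Fintype X] [Fintype Y] [AddGroup X] [AddGroup Y]
    {π : X → Y → ℝ} (hπ : IsInputDist π) (s : X) (t : Y) :
    IsInputDist fun x y => π (x + s) (y + t) := by
  refine ⟨fun _ _ => hπ.1 _ _, ?_⟩
  rw [← hπ.2]
  exact Fintype.sum_equiv (Equiv.addRight s) _ _ fun x =>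
    Fintype.sum_equiv (Equiv.addRight t) _ _ fun y => rfl

/-- The first party's response in the shifted and flipped winning strategy. -/
def shiftA (α γ s t c x : Bits 2) : Bits 2 := winA (x + s) + x * t + s * t + α * x + γ + c

/-- The second party's response in the shifted and flipped winning strategy. -/
def shiftB (β s t c y : Bits 2) : Bits 2 := winB (y + t) + s * y + β * y + c

/-- The shifted and flipped winning strategy with its input distribution. -/
def shiftTable (α β γ s t c : Bits 2) : TableN 2 := fun a b x y =>
  response (shiftA α γ s t c) a x * response (shiftB β s t c) b y * winInputs (x + s) (y + t)

theorem shiftTable_mem {H : ℝ} (hH : 1 / 10 ≤ H) (α β γ s t c : Bits 2) :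
    shiftTable α β γ s t c ∈ productTables (Bits 2) (Bits 2) (Bits 2) (Bits 2) H := by
  refine ⟨_, _, _, response_isCondDist _, response_isCondDist _, winInputs_isInputDist.shift s t,
    fun x y => le_trans ?_ hH, fun _ _ _ _ => rfl⟩
  unfold winInputs
  split_ifs <;> norm_num

/-- Expanding `(x + s)(y + t)`, the cross terms are local: the first party corrects `xt + st`, the
second `sy`. The common flip `c` cancels modulo two. -/
theorem shift_add_shift {α β γ s t c x y : Bits 2}
    (hw : winA (x + s) + winB (y + t) = (x + s) * (y + t)) :
    shiftA α γ s t c x + shiftB β s t c y = x * y + α * x + β * y + γ := by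
  have key : ∀ A B x y s t α β γ c : Fin 2, A + B = (x + s) * (y + t) →
      (A + x * t + s * t + α * x + γ + c) + (B + s * y + β * y + c) =
        x * y + α * x + β * y + γ := by
    decide +kernel
  exact funext fun j => key _ _ _ _ _ _ _ _ _ _ (congrFun hw j)

/-- On a winning input exactly one flip `c` gives the first party the output `a`, and then `b` is
right precisely when the PR relation holds. Losing inputs have probability zero. -/
theorem sum_flips (α β γ s t a b x y : Bits 2) :
    ∑ c, shiftTable α β γ s t c a b x y =
      (if a + b = x * y + α * x + β * y + γ then 1 else 0) * winInputs (x + s) (y + t) := by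
  simp only [shiftTable, ← Finset.sum_mul]
  by_cases hw : winA (x + s) + winB (y + t) = (x + s) * (y + t)
  · congr 1
    have hc : ∀ c : Bits 2, response (shiftA α γ s t c) a x * response (shiftB β s t c) b y =
        if c = a - shiftA α γ s t 0 x then
          (if a + b = x * y + α * x + β * y + γ then 1 else 0) else 0 := by
      intro c
      have h1 : c = a - shiftA α γ s t 0 x ↔ a = shiftA α γ s t c x := by
        have : shiftA α γ s t c x = shiftA α γ s t 0 x + c := by simp [shiftA]
        rw [this, eq_sub_iff_add_eq, add_comm c]
        exact eq_comm
      have h2 : a = shiftA α γ s t c x →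
          (a + b = x * y + α * x + β * y + γ ↔ b = shiftB β s t c y) := by
        intro h
        rw [← shift_add_shift (c := c) hw, h, add_right_inj]
      simp only [response, h1]
      by_cases h : a = shiftA α γ s t c x
      · simp only [if_pos h, h2 h, one_mul]
      · simp only [if_neg h, zero_mul]
    simp [hc]
  · simp [winInputs, hw]

/-- Averaging over both shifts makes the inputs uniform, since the translates of `winInputs` sum to
one at each pair. There are `4³ = 64` choices of `s`, `t`, `c`, and `1/64` is also the nonzero value
`(1/8)²` on the left. -/
theorem blockPower_prTable_eq (α β γ : Fin 2) :
    blockPower 2 (prTable α β γ) = ∑ k : Bits 2 × Bits 2 × Bits 2,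
      (1 / 64 : ℝ) • shiftTable (fun _ => α) (fun _ => β) (fun _ => γ) k.1 k.2.1 k.2.2 := by
  funext a b x y
  simp only [Finset.sum_apply, Pi.smul_apply, smul_eq_mul, ← Finset.mul_sum,
    Fintype.sum_prod_type, sum_flips]
  have h : ∑ s, ∑ t, winInputs (x + s) (y + t) = 1 := by
    have := (winInputs_isInputDist.shift x y).2
    simpa only [add_comm] using this
  rw [h, mul_one]
  simp only [blockPower, prTable]
  rw [prod_ite_fin_two]
  have : (∀ j, a j + b j = x j * y j + α * x j + β * y j + γ) ↔
      a + b = x * y + (fun _ => α) * x + (fun _ => β) * y + fun _ => γ := by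
    rw [funext_iff]; rfl
  simp only [this]
  split_ifs <;> norm_num

theorem blockPower_table_mem {H : ℝ} (hH : 1 / 10 ≤ H) (v : Vertex) :
    blockPower 2 v.table ∈
      convexHull ℝ (productTables (Bits 2) (Bits 2) (Bits 2) (Bits 2) H) := by
  rcases v with ⟨α, γ, β, δ⟩ | ⟨α, β, γ⟩
  · exact subset_convexHull ℝ _ (blockPower_detTable_mem (le_trans (by norm_num) hH) α γ β δ)
  · simp only [Vertex.table]
    rw [blockPower_prTable_eq]
    refine (convex_convexHull ℝ _).sum_mem (fun _ _ => by norm_num) ?_ fun k _ =>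
      subset_convexHull ℝ _ (shiftTable_mem hH _ _ _ _ _ _)
    simp only [Finset.sum_const, Finset.card_univ, Fintype.card_prod, Fintype.card_pi,
      Fintype.card_fin, nsmul_eq_mul]
    norm_num

theorem table_sum_eq_one {q : Table1} (hq : q ∈ Uniform1) : ∑ a, ∑ b, ∑ x, ∑ y, q a b x y = 1 := by
  rw [sum_swap_inputs]
  have : ∀ x y, ∑ a, ∑ b, q a b x y = 1 / 4 := fun x y => (hq x y).trans (by norm_num)
  simp only [this, Finset.sum_const, Finset.card_univ, Fintype.card_fin, nsmul_eq_mul]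
  norm_num

theorem NS1_subset_coarseGrain_MDL {h : ℝ} (hh : 1 / Real.sqrt 10 ≤ h) :
    NS1 ∩ Uniform1 ⊆ coarseGrain 2 '' (MDL 2 h ∩ UniformN 2) := by
  rintro q ⟨hq, hu⟩
  have hH : 1 / 10 ≤ h ^ 2 := by
    have h1 : (1 / Real.sqrt 10) ^ 2 = 1 / 10 := by
      rw [div_pow, Real.sq_sqrt (by norm_num), one_pow]
    rw [← h1]
    exact pow_le_pow_left₀ (by positivity) hh 2
  refine Set.image_mono convexHull_productTables_subset ?_
  obtain ⟨w, hw, rfl⟩ := exists_vertex_combination _ q hq.1.1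
    ((noSignalling_condProb_iff hu).1 hq.2) le_rfl
  have hconv := ((convex_convexHull ℝ (productTables (Bits 2) (Bits 2) (Bits 2) (Bits 2)
    (h ^ 2))).inter (convex_uniformN 2)).is_linear_image (coarseGrain_isLinearMap 2)
  refine hconv.sum_mem (fun v _ => hw v) ?_ fun v _ =>
    ⟨blockPower 2 v.table, ⟨blockPower_table_mem hH v,
      blockPower_mem_uniform 2 v.table_mem_uniform⟩,
      coarseGrain_blockPower (by norm_num) (table_sum_eq_one v.table_mem_uniform)⟩
  -- It remains to see that the vertex weights sum to one: every vertex, like the table itself, has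
  -- mass `1/4` at input `(0, 0)`.
  have h00 := hu 0 0
  have hv : ∀ v : Vertex, ∑ a, ∑ b, v.table a b 0 0 = 1 / 4 := fun v =>
    (v.table_mem_uniform 0 0).trans (by norm_num)
  simp only [inputProb, Finset.sum_apply, Pi.smul_apply, smul_eq_mul] at h00
  simp only [Finset.sum_comm (s := (Finset.univ : Finset (Fin 2)))
    (t := (Finset.univ : Finset Vertex)), ← Finset.mul_sum, hv, ← Finset.sum_mul] at h00
  simp only [Fintype.card_fin, Nat.cast_ofNat] at h00
  linarith

/-! ### Correlations of pure states -/

section Quantum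

/-- Parseval's identity for the adjoint of `T` applied to `ψ`, paired with `ψ`; it holds in every
Hilbert basis at once. -/
theorem hasTrace_rankOne_comp {H : Type} [NormedAddCommGroup H] [InnerProductSpace ℂ H]
    [CompleteSpace H] (ψ : H) (T : H →L[ℂ] H) :
    HasTrace (InnerProductSpace.rankOne ℂ ψ ψ ∘L T) ⟪ψ, T ψ⟫_ℂ := by
  intro ι e
  have h := e.hasSum_inner_mul_inner (ContinuousLinearMap.adjoint T ψ) ψ
  simp only [ContinuousLinearMap.adjoint_inner_left] at h
  simpa only [ContinuousLinearMap.comp_apply, InnerProductSpace.rankOne_apply, inner_smul_right]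
    using h

theorem isDensityOperator_rankOne {H : Type} [NormedAddCommGroup H] [InnerProductSpace ℂ H]
    [CompleteSpace H] {ψ : H} (hψ : ‖ψ‖ = 1) :
    IsDensityOperator (InnerProductSpace.rankOne ℂ ψ ψ) := by
  refine ⟨InnerProductSpace.isPositive_rankOne_self ψ, ?_⟩
  have h := hasTrace_rankOne_comp ψ 1
  rw [ContinuousLinearMap.one_def, ContinuousLinearMap.comp_id, ContinuousLinearMap.id_apply,
    inner_self_eq_norm_sq_to_K, hψ] at h
  simpa using h

variable {HA HB : Type} [NormedAddCommGroup HA] [InnerProductSpace ℂ HA]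
    [NormedAddCommGroup HB] [InnerProductSpace ℂ HB]

theorem mapL_rankOne (u : HA) (v : HB) :
    TensorProduct.mapL (InnerProductSpace.rankOne ℂ u u) (InnerProductSpace.rankOne ℂ v v) =
      InnerProductSpace.rankOne ℂ (u ⊗ₜ[ℂ] v) (u ⊗ₜ[ℂ] v) := by
  ext z
  induction z using TensorProduct.induction_on with
  | zero => rw [map_zero, map_zero]
  | tmul m n =>
    rw [TensorProduct.mapL_tmul, InnerProductSpace.rankOne_apply, InnerProductSpace.rankOne_apply,
      InnerProductSpace.rankOne_apply, TensorProduct.inner_tmul, TensorProduct.smul_tmul_smul]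
  | add z w hz hw => rw [map_add, map_add, hz, hw]

theorem tensorOp_one_one : tensorOp (1 : HA →L[ℂ] HA) (1 : HB →L[ℂ] HB) = 1 :=
  tensorOp_ext fun z => by
    rw [tensorOp_coe, ContinuousLinearMap.one_def, ContinuousLinearMap.one_def,
      TensorProduct.mapL_id_id]
    rfl

/-- The projective measurement in an orthonormal basis. -/
theorem isProjectiveMeasurement_rankOne {O : Type} [Fintype O] [CompleteSpace HA]
    (e : OrthonormalBasis O ℂ HA) :
    IsProjectiveMeasurement fun o => InnerProductSpace.rankOne ℂ (e o) (e o) :=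
  ⟨fun o => InnerProductSpace.isStarProjection_rankOne_self (e.orthonormal.1 o),
    e.sum_rankOne_eq_id⟩

variable {A B X Y : Type} [Fintype A] [Fintype B]

theorem isQuantumCorrelation_pure [CompleteSpace HA] [CompleteSpace HB]
    (eA : X → OrthonormalBasis A ℂ HA) (eB : Y → OrthonormalBasis B ℂ HB) {ψ : HA ⊗[ℂ] HB}
    (hψ : ‖ψ‖ = 1) :
    IsQuantumCorrelation fun a b x y => ‖⟪eA x a ⊗ₜ[ℂ] eB y b, ψ⟫_ℂ‖ ^ 2 := by
  refine ⟨HA, HB, _, _, inferInstance, _, _, inferInstance,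
    InnerProductSpace.rankOne ℂ (ψ : HilbertTensor HA HB) (ψ : HilbertTensor HA HB),
    fun x a => InnerProductSpace.rankOne ℂ (eA x a) (eA x a),
    fun y b => InnerProductSpace.rankOne ℂ (eB y b) (eB y b),
    isDensityOperator_rankOne (by rw [UniformSpace.Completion.norm_coe, hψ]),
    fun x => isProjectiveMeasurement_rankOne (eA x),
    fun y => isProjectiveMeasurement_rankOne (eB y), fun a b x y => ?_⟩
  have h := hasTrace_rankOne_comp (ψ : HilbertTensor HA HB)
    (tensorOp (InnerProductSpace.rankOne ℂ (eA x a) (eA x a))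
      (InnerProductSpace.rankOne ℂ (eB y b) (eB y b)))
  rw [tensorOp_coe, UniformSpace.Completion.inner_coe, mapL_rankOne,
    InnerProductSpace.rankOne_apply, inner_smul_right, ← inner_conj_symm ψ, Complex.mul_conj,
    Complex.normSq_eq_norm_sq] at h
  exact h

theorem IsQuantumCorrelation.sum_eq_one {r : Table A B X Y} (hr : IsQuantumCorrelation r) (x : X)
    (y : Y) : ∑ a, ∑ b, r a b x y = 1 := by
  obtain ⟨HA, HB, _, _, _, _, _, _, ρ, MA, MB, hρ, hA, hB, htr⟩ := hr
  have h := HasTrace.sum fun a => HasTrace.sum fun b => htr a b x y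
  simp only [← ContinuousLinearMap.comp_finsetSum, tensorOp_sum_right, (hB y).2,
    tensorOp_sum_left, (hA x).2, tensorOp_one_one] at h
  rw [ContinuousLinearMap.one_def, ContinuousLinearMap.comp_id] at h
  exact_mod_cast h.unique hρ.2

theorem IsQuantumCorrelation.uniform_mem [Fintype X] [Fintype Y] [Nonempty X] [Nonempty Y]
    {r : Table A B X Y} (hr : IsQuantumCorrelation r) (h0 : ∀ a b x y, 0 ≤ r a b x y) :
    (fun a b x y => r a b x y * (1 / ((Fintype.card X : ℝ) * (Fintype.card Y : ℝ)))) ∈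
      quantumSet A B X Y ∩ uniformInputs A B X Y := by
  have hu : (fun a b x y => r a b x y * (1 / ((Fintype.card X : ℝ) * (Fintype.card Y : ℝ)))) ∈
      uniformInputs A B X Y := by
    intro x y
    simp only [inputProb, ← Finset.sum_mul, hr.sum_eq_one x y, one_mul]
  refine ⟨⟨mem_probSpace_of_uniform (fun a b x y => mul_nonneg (h0 a b x y) (by positivity)) hu,
    r, ⟨Unit, inferInstance, Measure.dirac (), inferInstance, fun _ => r, fun _ => hr,
      fun _ _ _ _ => integrable_const _, fun _ _ _ _ => by simp⟩, fun a b x y => ?_⟩, hu⟩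
  rw [hu x y]

end Quantum

/-! ### A quantum realization of Hardy's paradox -/

theorem inner_real_pair (a b c d : ℝ) :
    ⟪!₂[(a : ℂ), (b : ℂ)], !₂[(c : ℂ), (d : ℂ)]⟫_ℂ = ((a * c + b * d : ℝ) : ℂ) := by
  rw [PiLp.inner_apply, Fin.sum_univ_two]
  simp [mul_comm]

/-- A real rotation of the standard basis of a qubit. -/
theorem exists_rotated_basis {c s : ℝ} (h : c * c + s * s = 1) :
    ∃ e : OrthonormalBasis (Fin 2) ℂ (EuclideanSpace ℂ (Fin 2)),
      e 0 = !₂[(c : ℂ), ((-s : ℝ) : ℂ)] ∧ e 1 = !₂[(s : ℂ), (c : ℂ)] := by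
  let v : Fin 2 → EuclideanSpace ℂ (Fin 2) :=
    ![!₂[(c : ℂ), ((-s : ℝ) : ℂ)], !₂[(s : ℂ), (c : ℂ)]]
  have hv : Orthonormal ℂ v := by
    rw [orthonormal_iff_ite]
    intro i j
    fin_cases i <;> fin_cases j
    · refine (inner_real_pair _ _ _ _).trans ?_
      rw [neg_mul_neg, h]
      simp
    · refine (inner_real_pair _ _ _ _).trans ?_
      rw [neg_mul, mul_comm, add_neg_cancel]
      simp
    · refine (inner_real_pair _ _ _ _).trans ?_
      rw [mul_neg, mul_comm, add_neg_cancel]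
      simp
    · refine (inner_real_pair _ _ _ _).trans ?_
      rw [add_comm, h]
      simp
  -- With `s` the whole index set there is nothing to extend; the dimension count alone makes the
  -- family a basis.
  obtain ⟨e, he⟩ := Orthonormal.exists_orthonormalBasis_extension_of_card_eq (𝕜 := ℂ)
    (ι := Fin 2) (v := v) (s := Set.univ) (by simp) (hv.comp _ Subtype.val_injective)
  exact ⟨e, he 0 trivial, he 1 trivial⟩

/-- Setting `1` is the basis `e` for both parties, and the state has no `e 1 ⊗ e 1` component, which
gives the last zero. The vectors `u 0` and `v 0` annihilate the coefficient pairs `(104, 672)` and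
`(104, 153)`, giving the other two. Pythagorean triples keep everything rational: `13² + 84² = 85²`,
`104² + 153² = 185²`, `185² + 672² = 697²`. -/
theorem exists_hardy_correlation : ∃ q ∈ Q1 ∩ Uniform1,
    q 0 0 0 0 ≠ 0 ∧ q 0 0 0 1 = 0 ∧ q 0 0 1 0 = 0 ∧ q 1 1 1 1 = 0 := by
  obtain ⟨e, he0, he1⟩ := exists_rotated_basis (c := 1) (s := 0) (by norm_num)
  obtain ⟨u, hu0, -⟩ := exists_rotated_basis (c := 84 / 85) (s := 13 / 85) (by norm_num)
  obtain ⟨v, hv0, -⟩ := exists_rotated_basis (c := 153 / 185) (s := 104 / 185) (by norm_num)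
  let ψ : EuclideanSpace ℂ (Fin 2) ⊗[ℂ] EuclideanSpace ℂ (Fin 2) :=
    ((104 / 697 : ℂ) • e 0) ⊗ₜ e 0 + ((153 / 697 : ℂ) • e 0) ⊗ₜ e 1
      + ((672 / 697 : ℂ) • e 1) ⊗ₜ e 0
  have hinner : ∀ x y : EuclideanSpace ℂ (Fin 2), ⟪x ⊗ₜ[ℂ] y, ψ⟫_ℂ =
      104 / 697 * ⟪x, e 0⟫_ℂ * ⟪y, e 0⟫_ℂ + 153 / 697 * ⟪x, e 0⟫_ℂ * ⟪y, e 1⟫_ℂ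
        + 672 / 697 * ⟪x, e 1⟫_ℂ * ⟪y, e 0⟫_ℂ := by
    intro x y
    rw [inner_add_right, inner_add_right, TensorProduct.inner_tmul, TensorProduct.inner_tmul,
      TensorProduct.inner_tmul, inner_smul_right, inner_smul_right, inner_smul_right]
  have hee := orthonormal_iff_ite.1 e.orthonormal
  have hψ : ‖ψ‖ = 1 := by
    have h : ⟪ψ, ψ⟫_ℂ = 1 := by
      nth_rw 1 [show ψ = ((104 / 697 : ℂ) • e 0) ⊗ₜ e 0 + ((153 / 697 : ℂ) • e 0) ⊗ₜ e 1
        + ((672 / 697 : ℂ) • e 1) ⊗ₜ e 0 from rfl]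
      rw [inner_add_left, inner_add_left, hinner, hinner, hinner]
      simp only [inner_smul_left, hee]
      simp [map_ofNat (starRingEnd ℂ)]
      norm_num
    have h' : ‖ψ‖ ^ 2 = 1 := by
      have h2 : ((‖ψ‖ : ℝ) : ℂ) ^ 2 = 1 :=
        (inner_self_eq_norm_sq_to_K (𝕜 := ℂ) ψ).symm.trans h
      exact_mod_cast h2
    exact (pow_eq_one_iff_of_nonneg (norm_nonneg ψ) two_ne_zero).1 h'
  have hq := (isQuantumCorrelation_pure ![u, e] ![v, e] hψ).uniform_mem fun _ _ _ _ => by positivity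
  refine ⟨_, hq, ?_⟩
  simp only [Matrix.cons_val_zero, Matrix.cons_val_one, hinner, he0, he1, hu0, hv0,
    inner_real_pair]
  norm_num

end BlockMDL

end

theorem mainTheorem2 :
    -- `c₂(NS₁^{×2}) = NS₁` on the uniform slices
    BlockMDL.coarseGrain 2 '' (BlockMDL.NSProd 2 ∩ BlockMDL.UniformN 2)
        = BlockMDL.NS1 ∩ BlockMDL.Uniform1 ∧
    -- `NS₁ ⊆ c₂(MDL₂)` if and only if `h ≥ 1/√10`
    (∀ h : ℝ, 0 ≤ h →
      (BlockMDL.NS1 ∩ BlockMDL.Uniform1 ⊆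
          BlockMDL.coarseGrain 2 '' (BlockMDL.MDL 2 h ∩ BlockMDL.UniformN 2) ↔
        1 / Real.sqrt 10 ≤ h)) ∧
    -- every local deterministic strategy is at least 6-mismatch for the uniform PR box
    (∀ f g : BlockMDL.Bits 2 → BlockMDL.Bits 2,
      6 ≤ BlockMDL.mismatchNumber 2 BlockMDL.uniformPR f g) ∧
    -- the uniform PR box is the witness below the threshold, even off the uniform slice of `MDL₂`
    BlockMDL.uniformPR ∈ BlockMDL.NS1 ∩ BlockMDL.Uniform1 ∧
    (∀ h : ℝ, 0 ≤ h → h < 1 / Real.sqrt 10 →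
      BlockMDL.uniformPR ∉ BlockMDL.coarseGrain 2 '' BlockMDL.MDL 2 h) ∧
    -- `c_N(Q_N) ⊆ c₂(MDL₂)` for all `N` whenever `h ≥ 1/√10`
    (∀ h : ℝ, 1 / Real.sqrt 10 ≤ h → ∀ N : ℕ, 1 ≤ N →
      BlockMDL.coarseGrain N '' (BlockMDL.QN N ∩ BlockMDL.UniformN N) ⊆
        BlockMDL.coarseGrain 2 '' (BlockMDL.MDL 2 h ∩ BlockMDL.UniformN 2)) ∧
    -- `Q₁ ⊄ c₂(MDL₂)` at least for `h < 1/√14`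
    (∀ h : ℝ, 0 ≤ h → h < 1 / Real.sqrt 14 →
      ¬ (BlockMDL.Q1 ∩ BlockMDL.Uniform1 ⊆ BlockMDL.coarseGrain 2 '' BlockMDL.MDL 2 h)) := by
  have notsub : ∀ h : ℝ, 0 ≤ h → h < 1 / Real.sqrt 10 →
      BlockMDL.uniformPR ∉ BlockMDL.coarseGrain 2 '' BlockMDL.MDL 2 h :=
    fun h h0 hlt => BlockMDL.uniformPR_notMem_coarseGrain_MDL h0 hlt
  refine ⟨BlockMDL.coarseGrain_image_NSProd, fun h h0 => ⟨fun hsub => ?_,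
    BlockMDL.NS1_subset_coarseGrain_MDL⟩, BlockMDL.six_le_mismatchNumber,
    BlockMDL.uniformPR_mem, notsub, ?_, ?_⟩
  · by_contra hlt
    exact notsub h h0 (not_le.1 hlt)
      (Set.image_mono Set.inter_subset_left (hsub BlockMDL.uniformPR_mem))
  · rintro h hh N hN _ ⟨p, ⟨hp, hu⟩, rfl⟩
    exact BlockMDL.NS1_subset_coarseGrain_MDL hh
      (BlockMDL.coarseGrain_mem_NS1 hN (BlockMDL.QN_subset_nsSet hp hu) hu)
  · intro h h0 hlt hsub
    obtain ⟨q, hq, h00, h01, h10, h11⟩ := BlockMDL.exists_hardy_correlation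
    exact BlockMDL.hardy_notMem_coarseGrain_MDL h0 hlt h00 h01 h10 h11 (hsub hq)
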